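/- Theorem 4.2. Let $n>1$ and let $M$ be a connected smooth manifold (Hausdorff, second countable, without boundary) of dimension $2n+1$ with a para-Sasakian structure $(\phi,\xi,\eta,g)$. That is: $\phi$ is a smooth $(1,1)$-tensor field, $\xi$ a smooth vector field, $\eta$ a smooth 1-form and $g$ a smooth pseudo-Riemannian metric with $\phi^2=I-\eta\otimes\xi$, $\eta(\xi)=1$, the eigenspaces of $\phi|_{\ker\eta}$ for the eigenvalues $1$ and $-1$ both of dimension $n$, $g(\phi X,\phi Y)=-g(X,Y)+\eta(X)\eta(Y)$, $d\eta(X,Y)=g(X,\phi Y)$ where $d\eta(X,Y)=\frac12\big(X\eta(Y)-Y\eta(X)-\eta([X,Y])\big)$, and $\phi^2[X,Y]+[\phi X,\phi Y]-\phi[X,\phi Y]-\phi[\phi X,Y]-2\,d\eta(X,Y)\,\xi=0$, for all smooth vector fields $X,Y$. Let $S$ be the Ricci tensor of $g$, $S(Y,Z)=\operatorname{tr}(X\mapsto R(X,Y)Z)$ with $R(X,Y)Z=\nabla_X\nabla_YZ-\nabla_Y\nabla_XZ-\nabla_{[X,Y]}Z$ for the Levi-Civita connection $\nabla$ of $g$.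 Let $p\in\mathbb R$, and suppose that $g$ is an almost conformal $\eta$-Ricci soliton: there are a smooth vector field $V$ and smooth functions $\lambda,\mu:M\to\mathbb R$ with $$\mathcal L_Vg+2S+\Big[2\lambda-\Big(p+\frac{2}{2n+1}\Big)\Big]g+2\mu\,\eta\otimes\eta=0 .$$ Suppose further that $V$ is an infinitesimal contact transformation: $\mathcal L_V\eta=a\,\eta$ for a smooth function $a:M\to\mathbb R$. Then $a$, $\lambda$ and $\mu$ are constant, so that the soliton is a conformal $\eta$-Ricci soliton (the same equation with constants $\lambda,\mu$). Moreover $M$ is $\eta$-Einstein, i.e. $S=\alpha g+\beta\,\eta\otimes\eta$ for some real constants $\alpha,\beta$, and either $V$ is Killing ($\mathcal L_Vg=0$) or $V$ leaves $\phi$ invariant ($\mathcal L_V\phi=0$). -/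

import Mathlib

open Bundle Module
open scoped Manifold ContDiff Topology

noncomputable section

namespace ParaSasaki

section Metric

variable {E : Type*} [NormedAddCommGroup E] [NormedSpace ℝ E]
  {M : Type*} [TopologicalSpace M] [ChartedSpace E M]
  [IsManifold 𝓘(ℝ, E) ∞ M]

/-- A smooth vector field on `M`, written `X ∈ χ(M)` on paper. -/
def IsSmoothField (X : Π x : M, TangentSpace 𝓘(ℝ, E) x) : Prop :=
  ContMDiff 𝓘(ℝ, E) (𝓘(ℝ, E).prod 𝓘(ℝ, E)) ∞
    (fun x ↦ (TotalSpace.mk x (X x) : TangentBundle 𝓘(ℝ, E) M))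

/-- The directional derivative `X f` of a function `f` along a vector field `X`. -/
def dirDeriv (X : Π x : M, TangentSpace 𝓘(ℝ, E) x) (f : M → ℝ) (x : M) : ℝ :=
  mvfderiv 𝓘(ℝ, E) f x (X x)

/-- The Lie bracket `[X, Y]` of vector fields. -/
abbrev bracket (X Y : Π x : M, TangentSpace 𝓘(ℝ, E) x) : Π x : M, TangentSpace 𝓘(ℝ, E) x :=
  VectorField.mlieBracket 𝓘(ℝ, E) X Y

variable (E M) in
/-- A smooth pseudo-Riemannian metric (of arbitrary signature): a smooth field of
nondegenerate symmetric bilinear forms on the tangent spaces. -/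
structure PseudoMetric where
  form (x : M) : TangentSpace 𝓘(ℝ, E) x →L[ℝ] TangentSpace 𝓘(ℝ, E) x →L[ℝ] ℝ
  symm (x : M) (v w : TangentSpace 𝓘(ℝ, E) x) : form x v w = form x w v
  nondegenerate (x : M) (v : TangentSpace 𝓘(ℝ, E) x) (hv : ∀ w, form x v w = 0) : v = 0
  contMDiff : ContMDiff 𝓘(ℝ, E) (𝓘(ℝ, E).prod 𝓘(ℝ, E →L[ℝ] E →L[ℝ] ℝ)) ∞
    (fun x ↦ TotalSpace.mk' (E →L[ℝ] E →L[ℝ] ℝ)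
      (E := fun x : M ↦ TangentSpace 𝓘(ℝ, E) x →L[ℝ] TangentSpace 𝓘(ℝ, E) x →L[ℝ] ℝ) x (form x))

namespace PseudoMetric

variable (g : PseudoMetric E M)

/-- The function `g(X, Y)`. -/
def pair (X Y : Π x : M, TangentSpace 𝓘(ℝ, E) x) (x : M) : ℝ := g.form x (X x) (Y x)

/-- The right-hand side of the Koszul formula
`2 g(∇_X Y, Z) = X g(Y,Z) + Y g(X,Z) - Z g(X,Y) + g([X,Y],Z) - g([X,Z],Y) - g([Y,Z],X)`. -/
def koszul (X Y Z : Π x : M, TangentSpace 𝓘(ℝ, E) x) (x : M) : ℝ :=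
  dirDeriv X (g.pair Y Z) x + dirDeriv Y (g.pair X Z) x - dirDeriv Z (g.pair X Y) x
    + g.pair (bracket X Y) Z x - g.pair (bracket X Z) Y x - g.pair (bracket Y Z) X x

variable {g}

lemma mdifferentiableAt_pair {X Y : Π x : M, TangentSpace 𝓘(ℝ, E) x} {x : M}
    (hX : MDiffAt (T% X) x) (hY : MDiffAt (T% Y) x) : MDiffAt (g.pair X Y) x := by
  have hg := (g.contMDiff x).mdifferentiableAt (by simp)
  have h : MDifferentiableAt 𝓘(ℝ, E) (𝓘(ℝ, E).prod 𝓘(ℝ))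
      (fun m ↦ TotalSpace.mk' ℝ (E := Bundle.Trivial M ℝ) m (g.form m (X m) (Y m))) x :=
    MDifferentiableAt.clm_bundle_apply₂ (F₁ := E) (F₂ := E) hg hX hY
  simp only [mdifferentiableAt_totalSpace] at h
  exact h.2

lemma pair_comm (X Y : Π x : M, TangentSpace 𝓘(ℝ, E) x) : g.pair X Y = g.pair Y X :=
  funext fun x ↦ g.symm x _ _

lemma pair_add_left (X X' Y : Π x : M, TangentSpace 𝓘(ℝ, E) x) :
    g.pair (X + X') Y = g.pair X Y + g.pair X' Y := by
  ext x; simp [pair]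

lemma pair_smul_left (f : M → ℝ) (X Y : Π x : M, TangentSpace 𝓘(ℝ, E) x) :
    g.pair (f • X) Y = f * g.pair X Y := by
  ext x; simp [pair]

lemma pair_add_right (X Y Y' : Π x : M, TangentSpace 𝓘(ℝ, E) x) :
    g.pair X (Y + Y') = g.pair X Y + g.pair X Y' := by
  ext x; simp [pair]

lemma pair_smul_right (f : M → ℝ) (X Y : Π x : M, TangentSpace 𝓘(ℝ, E) x) :
    g.pair X (f • Y) = f * g.pair X Y := by
  ext x; simp [pair]

variable (g) in
lemma eq_of_form_eq {x : M} {v w : TangentSpace 𝓘(ℝ, E) x}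
    (h : ∀ Z : Π x : M, TangentSpace 𝓘(ℝ, E) x, MDiffAt (T% Z) x →
      2 * g.form x v (Z x) = 2 * g.form x w (Z x)) : v = w := by
  refine sub_eq_zero.1 (g.nondegenerate x _ fun u ↦ ?_)
  have := h (FiberBundle.extend E u) (FiberBundle.mdifferentiableAt_extend 𝓘(ℝ, E) E u)
  rw [FiberBundle.extend_apply_self] at this
  rw [map_sub, sub_apply]
  linarith

variable [FiniteDimensional ℝ E]

section
variable {f : M → ℝ} {X X' Y Y' Z Z' : Π x : M, TangentSpace 𝓘(ℝ, E) x} {x : M}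

lemma koszul_add_left (hX : MDiffAt (T% X) x) (hX' : MDiffAt (T% X') x)
    (hY : MDiffAt (T% Y) x) (hZ : MDiffAt (T% Z) x) :
    g.koszul (X + X') Y Z x = g.koszul X Y Z x + g.koszul X' Y Z x := by
  simp only [koszul, pair_add_left, dirDeriv, mvfderiv_add (mdifferentiableAt_pair hX hZ)
    (mdifferentiableAt_pair hX' hZ), mvfderiv_add (mdifferentiableAt_pair hX hY)
    (mdifferentiableAt_pair hX' hY)]
  simp only [pair, bracket, VectorField.mlieBracket_add_left hX hX', Pi.add_apply, map_add,
    add_apply]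
  ring

lemma koszul_smul_left (hf : MDiffAt f x) (hX : MDiffAt (T% X) x)
    (hY : MDiffAt (T% Y) x) (hZ : MDiffAt (T% Z) x) :
    g.koszul (f • X) Y Z x = f x * g.koszul X Y Z x := by
  simp only [koszul, pair_smul_left, dirDeriv, mvfderiv_mul hf (mdifferentiableAt_pair hX hZ),
    mvfderiv_mul hf (mdifferentiableAt_pair hX hY)]
  simp only [pair, bracket, VectorField.mlieBracket_smul_left hf hX, Pi.smul_apply', map_add,
    map_smul, add_apply, smul_apply, smul_eq_mul,
    map_neg, neg_smul, neg_apply]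
  ring

lemma koszul_add_right (hX : MDiffAt (T% X) x) (hY : MDiffAt (T% Y) x)
    (hZ : MDiffAt (T% Z) x) (hZ' : MDiffAt (T% Z') x) :
    g.koszul X Y (Z + Z') x = g.koszul X Y Z x + g.koszul X Y Z' x := by
  simp only [koszul, pair_add_right, dirDeriv, mvfderiv_add (mdifferentiableAt_pair hX hZ)
    (mdifferentiableAt_pair hX hZ'), mvfderiv_add (mdifferentiableAt_pair hY hZ)
    (mdifferentiableAt_pair hY hZ')]
  simp only [pair, bracket, VectorField.mlieBracket_add_right hZ hZ', Pi.add_apply, map_add,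
    add_apply]
  ring

lemma koszul_smul_right (hf : MDiffAt f x) (hX : MDiffAt (T% X) x)
    (hY : MDiffAt (T% Y) x) (hZ : MDiffAt (T% Z) x) :
    g.koszul X Y (f • Z) x = f x * g.koszul X Y Z x := by
  simp only [koszul, pair_smul_right, dirDeriv, mvfderiv_mul hf (mdifferentiableAt_pair hX hZ),
    mvfderiv_mul hf (mdifferentiableAt_pair hY hZ)]
  simp only [pair, bracket, VectorField.mlieBracket_smul_right hf hZ, Pi.smul_apply', Pi.mul_apply,
    map_add,
    map_smul, add_apply, smul_apply, smul_eq_mul]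
  rw [g.symm x (Z x) (Y x), g.symm x (Z x) (X x)]
  ring

lemma koszul_add_middle (hX : MDiffAt (T% X) x) (hY : MDiffAt (T% Y) x)
    (hY' : MDiffAt (T% Y') x) (hZ : MDiffAt (T% Z) x) :
    g.koszul X (Y + Y') Z x = g.koszul X Y Z x + g.koszul X Y' Z x := by
  simp only [koszul, pair_add_left, pair_add_right, dirDeriv,
    mvfderiv_add (mdifferentiableAt_pair hX hY) (mdifferentiableAt_pair hX hY'),
    mvfderiv_add (mdifferentiableAt_pair hY hZ) (mdifferentiableAt_pair hY' hZ)]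
  simp only [pair, bracket, VectorField.mlieBracket_add_right hY hY',
    VectorField.mlieBracket_add_left hY hY', Pi.add_apply, map_add,
    add_apply]
  ring

lemma koszul_smul_middle (hf : MDiffAt f x) (hX : MDiffAt (T% X) x)
    (hY : MDiffAt (T% Y) x) (hZ : MDiffAt (T% Z) x) :
    g.koszul X (f • Y) Z x = f x * g.koszul X Y Z x
      + 2 * dirDeriv X f x * g.form x (Y x) (Z x) := by
  simp only [koszul, pair_smul_left, pair_smul_right, dirDeriv,
    mvfderiv_mul hf (mdifferentiableAt_pair hX hY), mvfderiv_mul hf (mdifferentiableAt_pair hY hZ)]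
  simp only [pair, bracket, VectorField.mlieBracket_smul_right hf hY,
    VectorField.mlieBracket_smul_left hf hY, Pi.smul_apply', Pi.mul_apply,
    map_add,
    map_smul, add_apply, smul_apply, smul_eq_mul,
    map_neg, neg_smul, neg_apply]
  rw [g.symm x (Y x) (X x)]
  ring

end

lemma tensorialAt_koszul_left {Y Z : Π x : M, TangentSpace 𝓘(ℝ, E) x} {x : M}
    (hY : MDiffAt (T% Y) x) (hZ : MDiffAt (T% Z) x) :
    TensorialAt 𝓘(ℝ, E) E (fun X ↦ g.koszul X Y Z x) x where
  smul hf hX := koszul_smul_left hf hX hY hZ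
  add hX hX' := koszul_add_left hX hX' hY hZ

lemma tensorialAt_koszul_right {X Y : Π x : M, TangentSpace 𝓘(ℝ, E) x} {x : M}
    (hX : MDiffAt (T% X) x) (hY : MDiffAt (T% Y) x) :
    TensorialAt 𝓘(ℝ, E) E (fun Z ↦ g.koszul X Y Z x) x where
  smul hf hZ := koszul_smul_right hf hX hY hZ
  add hZ hZ' := koszul_add_right hX hY hZ hZ'

variable (g)

/-- The isomorphism `v ↦ g(v, ·)` from the tangent space to its dual. -/
def flat (x : M) : TangentSpace 𝓘(ℝ, E) x ≃L[ℝ] (TangentSpace 𝓘(ℝ, E) x →L[ℝ] ℝ) :=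
  haveI : FiniteDimensional ℝ (TangentSpace 𝓘(ℝ, E) x) := inferInstanceAs (FiniteDimensional ℝ E)
  haveI : T2Space (TangentSpace 𝓘(ℝ, E) x) := inferInstanceAs (T2Space E)
  (LinearEquiv.ofInjectiveOfFinrankEq (g.form x).toLinearMap
    ((injective_iff_map_eq_zero _).2 fun v hv ↦ g.nondegenerate x v fun w ↦ by
      simpa using congr($hv w))
    (by
      rw [← (LinearMap.toContinuousLinearMap : (TangentSpace 𝓘(ℝ, E) x →ₗ[ℝ] ℝ) ≃ₗ[ℝ] _).finrank_eq]
      exact (Subspace.dual_finrank_eq).symm)).toContinuousLinearEquiv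

@[simp] lemma flat_apply (x : M) (v w : TangentSpace 𝓘(ℝ, E) x) :
    g.flat x v w = g.form x v w := rfl

open Classical in
/-- The Levi-Civita connection as a map on vector fields: `leviCivitaFun Y x v` is the vector
`∇_v Y` at `x` given by the Koszul formula, if `Y` is differentiable at `x`. -/
def leviCivitaFun (Y : Π x : M, TangentSpace 𝓘(ℝ, E) x) (x : M) :
    TangentSpace 𝓘(ℝ, E) x →L[ℝ] TangentSpace 𝓘(ℝ, E) x :=
  if hY : MDiffAt (T% Y) x then
    (1 / 2 : ℝ) • ((g.flat x).symm.toContinuousLinearMap ∘L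
      TensorialAt.mkHom₂ (I := 𝓘(ℝ, E)) (F := E) (F' := E) (fun X Z ↦ g.koszul X Y Z x) x
        (fun _ hZ ↦ tensorialAt_koszul_left hY hZ) (fun _ hX ↦ tensorialAt_koszul_right hX hY))
  else 0

lemma two_mul_form_leviCivitaFun {X Y Z : Π x : M, TangentSpace 𝓘(ℝ, E) x} {x : M}
    (hX : MDiffAt (T% X) x) (hY : MDiffAt (T% Y) x) (hZ : MDiffAt (T% Z) x) :
    2 * g.form x (g.leviCivitaFun Y x (X x)) (Z x) = g.koszul X Y Z x := by
  have h := TensorialAt.mkHom₂_apply (I := 𝓘(ℝ, E)) (F := E) (F' := E)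
    (Φ := fun X Z ↦ g.koszul X Y Z x) (fun _ hZ ↦ tensorialAt_koszul_left hY hZ)
    (fun _ hX ↦ tensorialAt_koszul_right hX hY) hX hZ
  rw [← h, leviCivitaFun, dif_pos hY, ← flat_apply]
  simp

/-- The Levi-Civita connection of a pseudo-Riemannian metric. In Mathlib's argument order,
`g.leviCivita Y x (X x)` is `(∇_X Y)(x)`. -/
def leviCivita : CovariantDerivative 𝓘(ℝ, E) E (fun x : M ↦ TangentSpace 𝓘(ℝ, E) x) where
  toFun := g.leviCivitaFun
  isCovariantDerivativeOnUniv :=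
    { add := by
        intro Y Y' x hY hY' _
        ext v
        have hv := FiberBundle.mdifferentiableAt_extend 𝓘(ℝ, E) E v
        have hYY := mdifferentiableAt_add_section hY hY'
        refine g.eq_of_form_eq fun Z hZ ↦ ?_
        have h₁ := g.two_mul_form_leviCivitaFun hv hY hZ
        have h₂ := g.two_mul_form_leviCivitaFun hv hY' hZ
        have h₃ := g.two_mul_form_leviCivitaFun hv hYY hZ
        rw [FiberBundle.extend_apply_self] at h₁ h₂ h₃
        rw [h₃, koszul_add_middle hv hY hY' hZ, ← h₁, ← h₂]
        simp only [add_apply, map_add]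
        ring
      leibniz := by
        intro Y f x hY hf _
        ext v
        have hv := FiberBundle.mdifferentiableAt_extend 𝓘(ℝ, E) E v
        have hfY := hf.smul_section hY
        refine g.eq_of_form_eq fun Z hZ ↦ ?_
        have h₁ := g.two_mul_form_leviCivitaFun hv hY hZ
        have h₃ := g.two_mul_form_leviCivitaFun hv hfY hZ
        rw [FiberBundle.extend_apply_self] at h₁ h₃
        rw [h₃, koszul_smul_middle hf hv hY hZ, ← h₁]
        simp only [dirDeriv, add_apply, map_add, map_smul,
          smul_apply, ContinuousLinearMap.smulRight_apply, smul_eq_mul,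
          FiberBundle.extend_apply_self]
        ring }

/-- The connection is torsion-free. -/
lemma leviCivita_torsion_free {X Y : Π x : M, TangentSpace 𝓘(ℝ, E) x} {x : M}
    (hX : MDiffAt (T% X) x) (hY : MDiffAt (T% Y) x) :
    g.leviCivita Y x (X x) - g.leviCivita X x (Y x) = bracket X Y x := by
  refine g.eq_of_form_eq fun Z hZ ↦ ?_
  have h₁ := g.two_mul_form_leviCivitaFun hX hY hZ
  have h₂ := g.two_mul_form_leviCivitaFun hY hX hZ
  have h₃ : bracket Y X x = - bracket X Y x := VectorField.mlieBracket_swap_apply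
  change 2 * g.form x (g.leviCivitaFun Y x (X x) - g.leviCivitaFun X x (Y x)) (Z x) = _
  rw [map_sub, sub_apply, mul_sub, h₁, h₂]
  simp only [koszul, pair, h₃, map_neg, neg_apply, g.pair_comm Y X]
  ring

/-- The connection is compatible with the metric. -/
lemma leviCivita_metric {X Y Z : Π x : M, TangentSpace 𝓘(ℝ, E) x} {x : M}
    (hX : MDiffAt (T% X) x) (hY : MDiffAt (T% Y) x) (hZ : MDiffAt (T% Z) x) :
    dirDeriv X (g.pair Y Z) x =
      g.form x (g.leviCivita Y x (X x)) (Z x) + g.form x (Y x) (g.leviCivita Z x (X x)) := by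
  have h₁ := g.two_mul_form_leviCivitaFun hX hY hZ
  have h₂ := g.two_mul_form_leviCivitaFun hX hZ hY
  have h₃ : bracket Z Y x = - bracket Y Z x := VectorField.mlieBracket_swap_apply
  change _ = g.form x (g.leviCivitaFun Y x (X x)) (Z x)
    + g.form x (Y x) (g.leviCivitaFun Z x (X x))
  rw [g.symm x (Y x)]
  simp only [koszul, pair, h₃, map_neg, neg_apply, g.pair_comm Z Y] at h₁ h₂
  linarith

/-- The curvature tensor `R(X, Y) Z = ∇_X ∇_Y Z - ∇_Y ∇_X Z - ∇_[X,Y] Z`. -/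
def curvature (X Y Z : Π x : M, TangentSpace 𝓘(ℝ, E) x) (x : M) : TangentSpace 𝓘(ℝ, E) x :=
  g.leviCivita (fun y ↦ g.leviCivita Z y (Y y)) x (X x)
    - g.leviCivita (fun y ↦ g.leviCivita Z y (X y)) x (Y x)
    - g.leviCivita Z x (bracket X Y x)

/-- The curvature tensor at a point, evaluated on tangent vectors through the extensions of these
to vector fields that are constant in a chart around the point. -/
def curvatureAt (x : M) (u v w : TangentSpace 𝓘(ℝ, E) x) : TangentSpace 𝓘(ℝ, E) x :=
  g.curvature (FiberBundle.extend E u) (FiberBundle.extend E v) (FiberBundle.extend E w) x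

/-- The Ricci tensor `S(v, w)`, the trace of `u ↦ R(u, v) w`, written out in a basis of the
tangent space. -/
def ricci (x : M) (v w : TangentSpace 𝓘(ℝ, E) x) : ℝ :=
  ∑ i, (Module.finBasis ℝ E).repr (g.curvatureAt x ((Module.finBasis ℝ E) i) v w) i

end PseudoMetric

end Metric

section Structure

variable (E : Type*) [NormedAddCommGroup E] [NormedSpace ℝ E]
  (M : Type*) [TopologicalSpace M] [ChartedSpace E M] [IsManifold 𝓘(ℝ, E) ∞ M]

/-- An almost paracontact metric structure `(φ, ξ, η, g)` on a manifold `M`, which is meant to be of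
dimension `2n + 1`. The `±1`-eigenspaces of the restriction of `φ` to the distribution `ker η` have
dimension `n`. -/
structure AlmostParacontactMetric (n : ℕ) where
  phi (x : M) : TangentSpace 𝓘(ℝ, E) x →L[ℝ] TangentSpace 𝓘(ℝ, E) x
  xi (x : M) : TangentSpace 𝓘(ℝ, E) x
  eta (x : M) : TangentSpace 𝓘(ℝ, E) x →L[ℝ] ℝ
  metric : PseudoMetric E M
  smooth_phi : ContMDiff 𝓘(ℝ, E) (𝓘(ℝ, E).prod 𝓘(ℝ, E →L[ℝ] E)) ∞
    (fun x ↦ TotalSpace.mk' (E →L[ℝ] E)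
      (E := fun x : M ↦ TangentSpace 𝓘(ℝ, E) x →L[ℝ] TangentSpace 𝓘(ℝ, E) x) x (phi x))
  smooth_xi : IsSmoothField xi
  smooth_eta : ContMDiff 𝓘(ℝ, E) (𝓘(ℝ, E).prod 𝓘(ℝ, E →L[ℝ] ℝ)) ∞
    (fun x ↦ TotalSpace.mk' (E →L[ℝ] ℝ)
      (E := fun x : M ↦ TangentSpace 𝓘(ℝ, E) x →L[ℝ] ℝ) x (eta x))
  phi_phi (x : M) (v : TangentSpace 𝓘(ℝ, E) x) : phi x (phi x v) = v - eta x v • xi x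
  eta_xi (x : M) : eta x (xi x) = 1
  finrank_plus (x : M) : finrank ℝ ↥(LinearMap.ker (eta x).toLinearMap ⊓
    Module.End.eigenspace (phi x).toLinearMap 1) = n
  finrank_minus (x : M) : finrank ℝ ↥(LinearMap.ker (eta x).toLinearMap ⊓
    Module.End.eigenspace (phi x).toLinearMap (-1)) = n
  compatible (x : M) (v w : TangentSpace 𝓘(ℝ, E) x) :
    metric.form x (phi x v) (phi x w) = -metric.form x v w + eta x v * eta x w

end Structure

namespace AlmostParacontactMetric

variable {E : Type*} [NormedAddCommGroup E] [NormedSpace ℝ E]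
  {M : Type*} [TopologicalSpace M] [ChartedSpace E M] [IsManifold 𝓘(ℝ, E) ∞ M]
  {n : ℕ} (P : AlmostParacontactMetric E M n)

/-- The vector field `φX`. -/
def phiField (X : Π x : M, TangentSpace 𝓘(ℝ, E) x) : Π x : M, TangentSpace 𝓘(ℝ, E) x :=
  fun x ↦ P.phi x (X x)

/-- The function `η(X)`. -/
def etaField (X : Π x : M, TangentSpace 𝓘(ℝ, E) x) : M → ℝ :=
  fun x ↦ P.eta x (X x)

/-- The exterior derivative `dη(X, Y) = (X η(Y) - Y η(X) - η([X, Y])) / 2`, in the normalization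
(with the factor `1/2`) used in paracontact geometry. -/
def dEta (X Y : Π x : M, TangentSpace 𝓘(ℝ, E) x) (x : M) : ℝ :=
  (dirDeriv X (P.etaField Y) x - dirDeriv Y (P.etaField X) x - P.eta x (bracket X Y x)) / 2

/-- The tensor `N(X, Y) = [φ, φ](X, Y) - 2 dη(X, Y) ξ`, where
`[φ, φ](X, Y) = φ²[X, Y] + [φX, φY] - φ[X, φY] - φ[φX, Y]`. -/
def normalityTensor (X Y : Π x : M, TangentSpace 𝓘(ℝ, E) x) (x : M) : TangentSpace 𝓘(ℝ, E) x :=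
  P.phi x (P.phi x (bracket X Y x)) + bracket (P.phiField X) (P.phiField Y) x
    - P.phi x (bracket X (P.phiField Y) x) - P.phi x (bracket (P.phiField X) Y x)
    - (2 * P.dEta X Y x) • P.xi x

/-- A para-Sasakian structure: a paracontact metric structure, i.e. `dη(X, Y) = g(X, φY)`,
which is normal, i.e. `N = 0`. -/
structure IsParaSasakian : Prop where
  paracontact (X Y : Π x : M, TangentSpace 𝓘(ℝ, E) x) (hX : IsSmoothField X)
    (hY : IsSmoothField Y) (x : M) : P.dEta X Y x = P.metric.form x (X x) (P.phi x (Y x))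
  normal (X Y : Π x : M, TangentSpace 𝓘(ℝ, E) x) (hX : IsSmoothField X)
    (hY : IsSmoothField Y) (x : M) : P.normalityTensor X Y x = 0

/-- The Lie derivative `(L_V g)(X, Y) = V g(X, Y) - g([V, X], Y) - g(X, [V, Y])`. -/
def lieMetric (V X Y : Π x : M, TangentSpace 𝓘(ℝ, E) x) (x : M) : ℝ :=
  dirDeriv V (P.metric.pair X Y) x - P.metric.form x (bracket V X x) (Y x)
    - P.metric.form x (X x) (bracket V Y x)

/-- The Lie derivative `(L_V η)(X) = V η(X) - η([V, X])`. -/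
def lieEta (V X : Π x : M, TangentSpace 𝓘(ℝ, E) x) (x : M) : ℝ :=
  dirDeriv V (P.etaField X) x - P.eta x (bracket V X x)

/-- The Lie derivative `(L_V φ)(X) = [V, φX] - φ[V, X]`. -/
def liePhi (V X : Π x : M, TangentSpace 𝓘(ℝ, E) x) (x : M) : TangentSpace 𝓘(ℝ, E) x :=
  bracket V (P.phiField X) x - P.phi x (bracket V X x)

/-- `V` is a Killing vector field: `L_V g = 0`. -/
def IsKilling (V : Π x : M, TangentSpace 𝓘(ℝ, E) x) : Prop :=
  ∀ X Y : Π x : M, TangentSpace 𝓘(ℝ, E) x, IsSmoothField X → IsSmoothField Y →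
    ∀ x, P.lieMetric V X Y x = 0

/-- `V` leaves `φ` invariant: `L_V φ = 0`. -/
def LeavesPhiInvariant (V : Π x : M, TangentSpace 𝓘(ℝ, E) x) : Prop :=
  ∀ X : Π x : M, TangentSpace 𝓘(ℝ, E) x, IsSmoothField X → ∀ x, P.liePhi V X x = 0

/-- `L_V η = a η`, the equation of an infinitesimal contact transformation. -/
def IsContactTransformation (V : Π x : M, TangentSpace 𝓘(ℝ, E) x) (a : M → ℝ) : Prop :=
  ∀ X : Π x : M, TangentSpace 𝓘(ℝ, E) x, IsSmoothField X →
    ∀ x, P.lieEta V X x = a x * P.eta x (X x)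

variable [FiniteDimensional ℝ E]

/-- The almost conformal `η`-Ricci soliton equation
`L_V g + 2 S + (2 λ - (p + 2 / (2n + 1))) g + 2 μ η ⊗ η = 0`, with smooth functions `λ`, `μ`, a
smooth vector field `V` and a real number `p`. -/
structure IsAlmostConformalEtaRicciSoliton (p : ℝ) (V : Π x : M, TangentSpace 𝓘(ℝ, E) x)
    (lam mu : M → ℝ) : Prop where
  smooth_field : IsSmoothField V
  smooth_lam : ContMDiff 𝓘(ℝ, E) 𝓘(ℝ) ∞ lam
  smooth_mu : ContMDiff 𝓘(ℝ, E) 𝓘(ℝ) ∞ mu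
  equation (X Y : Π x : M, TangentSpace 𝓘(ℝ, E) x) (hX : IsSmoothField X)
    (hY : IsSmoothField Y) (x : M) :
    P.lieMetric V X Y x + 2 * P.metric.ricci x (X x) (Y x)
      + (2 * lam x - (p + 2 / (2 * (n : ℝ) + 1))) * P.metric.form x (X x) (Y x)
      + 2 * mu x * (P.eta x (X x) * P.eta x (Y x)) = 0

/-- A conformal `η`-Ricci soliton: `λ` and `μ` are real constants. -/
def IsConformalEtaRicciSoliton (p : ℝ) (V : Π x : M, TangentSpace 𝓘(ℝ, E) x) (lam mu : ℝ) : Prop :=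
  P.IsAlmostConformalEtaRicciSoliton p V (fun _ ↦ lam) (fun _ ↦ mu)

/-- `M` is `η`-Einstein: `S = α g + β η ⊗ η` for real constants `α`, `β`. -/
def IsEtaEinstein : Prop :=
  ∃ α β : ℝ, ∀ (x : M) (v w : TangentSpace 𝓘(ℝ, E) x),
    P.metric.ricci x v w = α * P.metric.form x v w + β * (P.eta x v * P.eta x w)

end AlmostParacontactMetric

end ParaSasaki

end

/-! The argument is tensor calculus, carried out over the ring `A` of smooth functions acting on the
module `𝔛` of smooth fields. Write `Φ(X, Y) = g(X, φY)`, so `dη = Φ`, and absorb the constant `p +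
2/(2n+1)` into `λ`.

Para-Sasakian geometry gives `∇ξ = -φ` and `(∇_X φ)Y = -g(X, Y)ξ + η(Y)X` (`nabla_xi`,
`nablaPhi_eq`). Hence `S(Y, ξ) = -2n η(Y)`, and commuting `φ` past the curvature shows that `S(·,
φ·)` is skew (`ricci_phi_skew`). Moreover `tr(φ R(X, Y)) = -2 (S(X, φY) + (2n-1) Φ(X, Y))`, and this
form is closed by the second Bianchi identity (`trace_phi_comp_curvature_closed`).

For the soliton, inserting `ξ` gives `[V, ξ] = -aξ` and `a = 2n - λ - μ`. Then `L_V φ` anticommutes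
with `φ`. Applying `L_V` to `dη = Φ` first yields `da = (ξa) η`, so `a` is constant because `d(da) =
0` while `dη` is nonzero on `ker η`. It then yields `g(X, (L_V φ)Y) = 2 S(X, φY) + (2λ + a) Φ(X,
Y)`. The operator on the right commutes with `φ` and the one on the left anticommutes, so both
vanish. Thus `L_V φ = 0` always, and `S(X, φY) = α Φ(X, Y)` with `α = -(λ + a/2)`. Closedness forces
`dα ∧ Φ = 0`, whence `dα = 0` since `n > 1` (`deriv_eq_zero_of_ricci_phi`). So `λ`, and then `μ`, is
constant and `S` is determined.

The remaining work shows that smooth fields form such an algebra. The substantial points are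
smoothness of metric duals and of traces, and agreement of the pointwise Ricci tensor with the
algebraic one. -/

noncomputable section

/-! ### Levi-Civita calculus over a commutative ring of functions -/

namespace ParaSasaki

/-- The algebraic structure carried by the module `𝔛` of smooth vector fields of a
pseudo-Riemannian manifold over the algebra `A` of smooth functions: directional derivatives, the
Levi-Civita connection, the metric and the trace of endomorphism fields. -/
structure LeviCivitaAlgebra (A 𝔛 : Type*) [CommRing A] [Algebra ℝ A] [AddCommGroup 𝔛]
    [Module A 𝔛] where
  deriv : 𝔛 →ₗ[A] Derivation ℝ A A
  nabla : 𝔛 →ₗ[A] (𝔛 →+ 𝔛)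
  metric : 𝔛 →ₗ[A] 𝔛 →ₗ[A] A
  trace : (𝔛 →ₗ[A] 𝔛) →ₗ[A] A
  metric_symm (X Y : 𝔛) : metric X Y = metric Y X
  metric_nondegenerate (X : 𝔛) (hX : ∀ Y, metric X Y = 0) : X = 0
  exists_metric_eq (l : 𝔛 →ₗ[A] A) : ∃ X, ∀ Y, metric X Y = l Y
  nabla_smul (X : 𝔛) (f : A) (Y : 𝔛) : nabla X (f • Y) = deriv X f • Y + f • nabla X Y
  deriv_metric (X Y Z : 𝔛) :
    deriv X (metric Y Z) = metric (nabla X Y) Z + metric Y (nabla X Z)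
  -- Torsion-freeness is built in: the bracket is not primitive, and `∇_X Y - ∇_Y X` takes its place
  -- here and in `jacobi`.
  deriv_nabla_sub (X Y : 𝔛) (f : A) :
    deriv (nabla X Y - nabla Y X) f = deriv X (deriv Y f) - deriv Y (deriv X f)
  jacobi (X Y Z : 𝔛) :
    nabla X (nabla Y Z - nabla Z Y) - nabla (nabla Y Z - nabla Z Y) X
      + (nabla Y (nabla Z X - nabla X Z) - nabla (nabla Z X - nabla X Z) Y)
      + (nabla Z (nabla X Y - nabla Y X) - nabla (nabla X Y - nabla Y X) Z) = 0
  trace_smulRight (l : 𝔛 →ₗ[A] A) (Y : 𝔛) : trace (l.smulRight Y) = l Y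
  trace_comp_comm (S T : 𝔛 →ₗ[A] 𝔛) : trace (S ∘ₗ T) = trace (T ∘ₗ S)
  trace_adjoint (S T : 𝔛 →ₗ[A] 𝔛) (h : ∀ X Y, metric (S X) Y = metric X (T Y)) :
    trace S = trace T
  -- `T` stands for `∇_W S`, whose linearity is only proved later, in `nablaEnd`.
  deriv_trace (W : 𝔛) (S T : 𝔛 →ₗ[A] 𝔛) (h : ∀ X, T X = nabla W (S X) - S (nabla W X)) :
    deriv W (trace S) = trace T

namespace LeviCivitaAlgebra

variable {A 𝔛 : Type*} [CommRing A] [Algebra ℝ A] [AddCommGroup 𝔛] [Module A 𝔛]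

/-- Since `A` may have zero divisors, integers are cancelled through the real scalars. -/
lemma eq_zero_of_natCast_mul {k : ℕ} (hk : k ≠ 0) {f : A} (h : (k : A) * f = 0) : f = 0 := by
  have h₁ : ((k : ℝ)⁻¹ * (k : ℝ)) • f = 0 := by
    rw [mul_smul, Nat.cast_smul_eq_nsmul, nsmul_eq_mul, h, smul_zero]
  rwa [inv_mul_cancel₀ (by exact_mod_cast hk), one_smul] at h₁

lemma eq_of_two_mul {f h : A} (e : 2 * f = 2 * h) : f = h :=
  sub_eq_zero.1 (eq_zero_of_natCast_mul two_ne_zero (by push_cast; linear_combination e))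

variable (L : LeviCivitaAlgebra A 𝔛)

lemma eq_of_metric_eq {X Y : 𝔛} (h : ∀ Z, L.metric X Z = L.metric Y Z) : X = Y :=
  sub_eq_zero.1 (L.metric_nondegenerate _ fun Z ↦ by simp [h])

/-- The Lie bracket of vector fields. -/
def bracket (X Y : 𝔛) : 𝔛 := L.nabla X Y - L.nabla Y X

lemma deriv_bracket (X Y : 𝔛) (f : A) :
    L.deriv (L.bracket X Y) f = L.deriv X (L.deriv Y f) - L.deriv Y (L.deriv X f) :=
  L.deriv_nabla_sub X Y f

lemma deriv_mul (X : 𝔛) (f h : A) :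
    L.deriv X (f * h) = L.deriv X f * h + f * L.deriv X h := by
  rw [Derivation.leibniz, smul_eq_mul, smul_eq_mul]; ring

@[simp] lemma deriv_natCast (X : 𝔛) (k : ℕ) : L.deriv X (k : A) = 0 :=
  (L.deriv X).map_natCast k

@[simp] lemma deriv_two (X : 𝔛) : L.deriv X (2 : A) = 0 := by
  exact_mod_cast L.deriv_natCast X 2

lemma nabla_smul_left (f : A) (X Y : 𝔛) : L.nabla (f • X) Y = f • L.nabla X Y := by
  rw [map_smul]; rfl

lemma nabla_add_left (X X' Y : 𝔛) : L.nabla (X + X') Y = L.nabla X Y + L.nabla X' Y := by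
  rw [map_add]; rfl

lemma nabla_sub_left (X X' Y : 𝔛) : L.nabla (X - X') Y = L.nabla X Y - L.nabla X' Y := by
  rw [map_sub]; rfl

/-- The curvature `R(X, Y) Z`. -/
def curvatureFun (X Y Z : 𝔛) : 𝔛 :=
  L.nabla X (L.nabla Y Z) - L.nabla Y (L.nabla X Z) - L.nabla (L.bracket X Y) Z

/-- The endomorphism `R(X, Y)`. -/
def curvature (X Y : 𝔛) : 𝔛 →ₗ[A] 𝔛 where
  toFun Z := L.curvatureFun X Y Z
  map_add' Z Z' := by
    simp only [curvatureFun, map_add]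
    abel
  map_smul' f Z := by
    simp only [curvatureFun, nabla_smul, map_add, RingHom.id_apply, deriv_bracket]
    module

lemma curvature_apply (X Y Z : 𝔛) : L.curvature X Y Z =
    L.nabla X (L.nabla Y Z) - L.nabla Y (L.nabla X Z) - L.nabla (L.bracket X Y) Z := rfl

lemma curvature_swap (X Y Z : 𝔛) : L.curvature X Y Z = -L.curvature Y X Z := by
  simp only [curvature_apply, bracket, nabla_sub_left]
  abel

lemma bianchi (X Y Z : 𝔛) :
    L.curvature X Y Z + L.curvature Y Z X + L.curvature Z X Y = 0 := by
  rw [← L.jacobi X Y Z]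
  simp only [curvature_apply, bracket, map_sub]
  abel

/-- The commutator of derivatives applied to the function `g(Z, W)`, expanded by metric
compatibility. -/
lemma metric_curvature_skew (X Y Z W : 𝔛) :
    L.metric (L.curvature X Y Z) W = -L.metric Z (L.curvature X Y W) := by
  have h := L.deriv_bracket X Y (L.metric Z W)
  simp only [deriv_metric, map_add] at h
  simp only [curvature_apply, map_sub, LinearMap.sub_apply]
  linear_combination -h

/-- The usual octahedron argument: four first Bianchi identities, combined using skewness in each
pair. -/
lemma metric_curvature_pair_symm (X Y Z W : 𝔛) :
    L.metric (L.curvature X Y Z) W = L.metric (L.curvature Z W X) Y := by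
  have b (X Y Z W : 𝔛) : L.metric (L.curvature X Y Z) W + L.metric (L.curvature Y Z X) W
      + L.metric (L.curvature Z X Y) W = 0 := by
    rw [← LinearMap.add_apply, ← LinearMap.add_apply, ← map_add, ← map_add, L.bianchi]; simp
  have s (X Y Z W : 𝔛) : L.metric (L.curvature X Y Z) W = -L.metric (L.curvature X Y W) Z := by
    rw [L.metric_curvature_skew, L.metric_symm]
  have t (X Y Z W : 𝔛) : L.metric (L.curvature X Y Z) W = -L.metric (L.curvature Y X Z) W := by
    rw [L.curvature_swap, map_neg, LinearMap.neg_apply]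
  refine eq_of_two_mul ?_
  linear_combination b X Y Z W + b Y Z W X - b Z W X Y - b W X Y Z + s X Y Z W - s Y Z X W
    - s Z W Y X + s W X Z Y - t Z X Y W + s X Z Y W - t W Y Z X + s Y W Z X

/-- The endomorphism `U ↦ R(U, Y) Z`. -/
def ricciEnd (Y Z : 𝔛) : 𝔛 →ₗ[A] 𝔛 where
  toFun U := L.curvature U Y Z
  -- Linearity in the first slot is moved by pair symmetry to linearity of the endomorphism `R(Z,
  -- W)`.
  map_add' U U' := L.eq_of_metric_eq fun W ↦ by
    simp only [map_add, LinearMap.add_apply, L.metric_curvature_pair_symm _ Y Z W]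
  map_smul' f U := L.eq_of_metric_eq fun W ↦ by
    simp only [map_smul, LinearMap.smul_apply, L.metric_curvature_pair_symm _ Y Z W,
      RingHom.id_apply]

@[simp] lemma ricciEnd_apply (U Y Z : 𝔛) : L.ricciEnd Y Z U = L.curvature U Y Z := rfl

/-- The Ricci tensor. -/
def ricci (Y Z : 𝔛) : A := L.trace (L.ricciEnd Y Z)

lemma ricci_add_right (Y Z Z' : 𝔛) : L.ricci Y (Z + Z') = L.ricci Y Z + L.ricci Y Z' := by
  rw [ricci, ricci, ricci, ← map_add]
  exact congrArg L.trace (LinearMap.ext fun U ↦ map_add (L.curvature U Y) Z Z')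

lemma ricci_smul_right (Y : 𝔛) (f : A) (Z : 𝔛) : L.ricci Y (f • Z) = f * L.ricci Y Z := by
  rw [ricci, ricci, ← smul_eq_mul, ← map_smul]
  exact congrArg L.trace (LinearMap.ext fun U ↦ map_smul (L.curvature U Y) f Z)

end LeviCivitaAlgebra

end ParaSasaki

end

/-! ### First identities of a para-Sasakian structure -/

noncomputable section

namespace ParaSasaki

/-- The algebraic structure carried by the vector fields of a para-Sasakian manifold of dimension
`2n + 1`. -/
structure ParaSasakiAlgebra (A 𝔛 : Type*) [CommRing A] [Algebra ℝ A] [AddCommGroup 𝔛]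
    [Module A 𝔛] (n : ℕ) extends LeviCivitaAlgebra A 𝔛 where
  phi : 𝔛 →ₗ[A] 𝔛
  xi : 𝔛
  eta : 𝔛 →ₗ[A] A
  phi_phi (X : 𝔛) : phi (phi X) = X - eta X • xi
  eta_xi : eta xi = 1
  compatible (X Y : 𝔛) : metric (phi X) (phi Y) = -metric X Y + eta X * eta Y
  paracontact (X Y : 𝔛) : deriv X (eta Y) - deriv Y (eta X) - eta (nabla X Y - nabla Y X) =
    2 * metric X (phi Y)
  normal (X Y : 𝔛) : phi (phi (nabla X Y - nabla Y X)) +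
    (nabla (phi X) (phi Y) - nabla (phi Y) (phi X)) - phi (nabla X (phi Y) - nabla (phi Y) X)
      - phi (nabla (phi X) Y - nabla Y (phi X)) - (2 * metric X (phi Y)) • xi = 0
  trace_id : trace LinearMap.id = 2 * (n : A) + 1

namespace ParaSasakiAlgebra

open LeviCivitaAlgebra

variable {A 𝔛 : Type*} [CommRing A] [Algebra ℝ A] [AddCommGroup 𝔛] [Module A 𝔛] {n : ℕ}
  (P : ParaSasakiAlgebra A 𝔛 n)

/-- `dη` is alternating, hence so is `g(X, φY)`. -/
lemma metric_phi_left (X Y : 𝔛) : P.metric (P.phi X) Y = -P.metric X (P.phi Y) := by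
  refine eq_of_two_mul ?_
  have h₁ := P.paracontact X Y
  have h₂ := P.paracontact Y X
  simp only [map_sub] at h₁ h₂
  rw [P.metric_symm (P.phi X) Y]
  linear_combination -h₁ - h₂

lemma metric_phi_phi (X Y : 𝔛) :
    P.metric X (P.phi (P.phi Y)) = P.metric X Y - P.eta X * P.eta Y := by
  have h := P.metric_phi_left X (P.phi Y)
  rw [P.compatible] at h
  linear_combination h

/-- With `c = η(φξ)`, the identity `φ² = I - η ⊗ ξ` yields `φξ = cξ` and `c² = 0`. In a ring that
may have nilpotents `c = 0` does not follow yet, but in `compatible` at `ξ` only `c²` survives. -/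
lemma metric_xi (X : 𝔛) : P.metric X P.xi = P.eta X := by
  have h₁ : P.phi P.xi = P.eta (P.phi P.xi) • P.xi := by
    have h : P.phi (P.phi (P.phi P.xi)) = 0 := by
      rw [P.phi_phi P.xi, P.eta_xi, one_smul, sub_self, map_zero]
    rw [P.phi_phi] at h
    exact sub_eq_zero.1 h
  have h₂ := P.compatible X P.xi
  have h₃ : P.eta (P.phi P.xi) * P.eta (P.phi P.xi) = 0 := by
    have h : P.phi (P.phi P.xi) = 0 := by rw [P.phi_phi P.xi, P.eta_xi, one_smul, sub_self]
    rw [h₁, map_smul, h₁, smul_smul] at h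
    simpa [P.eta_xi] using congr(P.eta $h)
  rw [h₁, map_smul, metric_phi_left, h₁, map_smul, P.eta_xi, smul_eq_mul,
    smul_eq_mul, map_smul, smul_eq_mul] at h₂
  linear_combination h₂ + P.metric X P.xi * h₃

lemma metric_xi_left (X : 𝔛) : P.metric P.xi X = P.eta X := by
  rw [P.metric_symm, metric_xi]

@[simp] lemma phi_xi : P.phi P.xi = 0 :=
  P.metric_nondegenerate _ fun Y ↦ by
    have h₁ : P.phi (P.phi P.xi) = 0 := by rw [P.phi_phi P.xi, P.eta_xi, one_smul, sub_self]
    have h₂ : P.eta (P.phi P.xi) = 0 := by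
      refine eq_of_two_mul ?_
      have := P.metric_phi_left P.xi P.xi
      rw [metric_xi, metric_xi_left] at this
      linear_combination this
    have h₃ := P.metric_phi_phi Y (P.phi P.xi)
    rw [h₁, map_zero, map_zero, h₂] at h₃
    rw [P.metric_symm]
    linear_combination -h₃

@[simp] lemma eta_phi (X : 𝔛) : P.eta (P.phi X) = 0 := by
  rw [← metric_xi, metric_phi_left, phi_xi, map_zero, neg_zero]

@[simp] lemma phi_phi_phi (X : 𝔛) : P.phi (P.phi (P.phi X)) = P.phi X := by
  rw [P.phi_phi, eta_phi, zero_smul, sub_zero]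

lemma deriv_eta (X Y : 𝔛) : P.deriv X (P.eta Y) =
    P.metric (P.nabla X P.xi) Y + P.eta (P.nabla X Y) := by
  rw [← metric_xi_left, deriv_metric, metric_xi_left]

lemma metric_nabla_xi_sub (X Y : 𝔛) :
    P.metric (P.nabla X P.xi) Y - P.metric (P.nabla Y P.xi) X = 2 * P.metric X (P.phi Y) := by
  rw [← P.paracontact, map_sub, deriv_eta, deriv_eta]
  ring

lemma eta_nabla_xi (X : 𝔛) : P.eta (P.nabla X P.xi) = 0 := by
  have h := P.deriv_eta X P.xi
  rw [P.eta_xi, metric_xi, Derivation.map_one_eq_zero] at h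
  exact eq_of_two_mul (by linear_combination -h)

/-- The covariant derivative `(∇_X φ) Y`. -/
def nablaPhi (X Y : 𝔛) : 𝔛 := P.nabla X (P.phi Y) - P.phi (P.nabla X Y)

lemma nablaPhi_xi (X : 𝔛) : P.nablaPhi X P.xi = -P.phi (P.nabla X P.xi) := by
  simp [nablaPhi]

lemma metric_nablaPhi_skew (X Y Z : 𝔛) :
    P.metric (P.nablaPhi X Y) Z = -P.metric Y (P.nablaPhi X Z) := by
  have h : P.deriv X (P.metric (P.phi Y) Z) = P.deriv X (-P.metric Y (P.phi Z)) := by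
    rw [metric_phi_left]
  rw [map_neg, deriv_metric, deriv_metric] at h
  simp only [nablaPhi, map_sub, LinearMap.sub_apply]
  rw [P.metric_phi_left (P.nabla X Y) Z]
  rw [P.metric_phi_left Y (P.nabla X Z)] at h
  linear_combination h

/-- The fundamental form `g(X, φY)` is closed. -/
lemma metric_nablaPhi_cyclic (X Y Z : 𝔛) :
    P.metric (P.nablaPhi X Y) Z + P.metric (P.nablaPhi Y Z) X +
      P.metric (P.nablaPhi Z X) Y = 0 := by
  -- These are the terms of `d(dη) = 0`: `d` differentiates `dη(Y, Z)` along `X`, `b` evaluates `dη`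
  -- on a bracket, and `j` is Jacobi under `η`.
  have d (X Y Z : 𝔛) : 2 * (P.metric (P.nabla X Y) (P.phi Z) + P.metric Y (P.nabla X (P.phi Z))) =
      P.deriv X (P.deriv Y (P.eta Z)) - P.deriv X (P.deriv Z (P.eta Y)) -
        P.deriv X (P.eta (P.nabla Y Z)) + P.deriv X (P.eta (P.nabla Z Y)) := by
    have h := congr(P.deriv X $(P.paracontact Y Z))
    rw [LeviCivitaAlgebra.deriv_mul, deriv_metric] at h
    simp only [map_sub] at h
    rw [deriv_two] at h
    linear_combination -h
  have b (X Y Z : 𝔛) : P.deriv X (P.eta (P.bracket Y Z)) - P.deriv (P.bracket Y Z) (P.eta X)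
      - P.eta (P.bracket X (P.bracket Y Z)) = 2 * P.metric X (P.phi (P.bracket Y Z)) :=
    P.paracontact X (P.bracket Y Z)
  have j : P.eta (P.bracket X (P.bracket Y Z)) + P.eta (P.bracket Y (P.bracket Z X)) +
      P.eta (P.bracket Z (P.bracket X Y)) = 0 := by
    rw [← map_add, ← map_add]
    exact (congrArg P.eta (P.jacobi X Y Z)).trans (map_zero _)
  have b₁ := b X Y Z
  have b₂ := b Y Z X
  have b₃ := b Z X Y
  rw [deriv_bracket] at b₁ b₂ b₃
  simp only [LeviCivitaAlgebra.bracket, map_sub] at b₁ b₂ b₃ j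
  have s (X Y : 𝔛) : P.metric X (P.phi Y) = -P.metric Y (P.phi X) := by
    rw [← metric_phi_left, P.metric_symm]
  refine eq_of_two_mul ?_
  rw [P.metric_nablaPhi_skew X, P.metric_nablaPhi_skew Y, P.metric_nablaPhi_skew Z]
  simp only [nablaPhi, map_sub]
  linear_combination - d X Y Z - d Y Z X - d Z X Y + b₁ + b₂ + b₃ + j
    + 2 * s (P.nabla X Y) Z + 2 * s (P.nabla Y Z) X + 2 * s (P.nabla Z X) Y

/-- The covariant derivative of `φ² = I - η ⊗ ξ`. -/
lemma nablaPhi_phi (X Y : 𝔛) : P.nablaPhi X (P.phi Y) + P.phi (P.nablaPhi X Y) =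
    -(P.metric (P.nabla X P.xi) Y • P.xi) - P.eta Y • P.nabla X P.xi := by
  simp only [nablaPhi, map_sub, P.phi_phi, nabla_smul, deriv_eta]
  module

/-- Normality rewritten through `∇φ`: brackets are differences of covariant derivatives, and the
terms in which `φ` is not differentiated cancel. -/
lemma nablaPhi_normal (X Y : 𝔛) : P.nablaPhi (P.phi X) Y - P.nablaPhi (P.phi Y) X
    + P.phi (P.nablaPhi Y X) - P.phi (P.nablaPhi X Y) = (2 * P.metric X (P.phi Y)) • P.xi := by
  have h := P.normal X Y
  simp only [map_sub] at h
  simp only [nablaPhi, map_sub]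
  rw [← sub_eq_zero, ← h]
  abel

end ParaSasakiAlgebra

end ParaSasaki

end

/-! ### The covariant derivatives of `ξ` and `φ`, and the curvature -/

noncomputable section

namespace ParaSasaki
namespace ParaSasakiAlgebra

open LeviCivitaAlgebra

variable {A 𝔛 : Type*} [CommRing A] [Algebra ℝ A] [AddCommGroup 𝔛] [Module A 𝔛] {n : ℕ}
  (P : ParaSasakiAlgebra A 𝔛 n)

lemma eq_phi_phi_add (X : 𝔛) : X = P.phi (P.phi X) + P.eta X • P.xi := by
  rw [P.phi_phi, sub_add_cancel]

/-- Normality against `ξ` involves `∇_ξ φ`, which closedness of `Φ` trades for `∇ξ`. The skew part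
of `∇ξ` is `dη`, and together these determine `∇ξ` on the image of `φ`. -/
lemma metric_nabla_phi_xi (X Y : 𝔛) :
    P.metric (P.nabla (P.phi X) P.xi) (P.phi Y) = -P.metric X (P.phi Y) := by
  have h₁ := congr(P.metric $(P.nablaPhi_normal X P.xi) Y)
  have h₂ := P.metric_nablaPhi_cyclic P.xi X (P.phi Y)
  have h₃ := P.metric_nabla_xi_sub (P.phi X) (P.phi Y)
  have h₄ := P.metric_phi_phi (P.phi X) Y
  have h₅ : P.nablaPhi 0 X = 0 := by simp [nablaPhi]
  rw [P.metric_nablaPhi_skew X, P.metric_symm (P.phi Y)] at h₂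
  rw [phi_xi, h₅] at h₁
  simp only [nablaPhi_xi, map_zero, map_neg, map_sub, map_add, LinearMap.add_apply,
    LinearMap.sub_apply, LinearMap.neg_apply, metric_phi_left, mul_zero, zero_smul, eta_phi,
    zero_mul, LinearMap.zero_apply] at h₁ h₂ h₃ h₄
  refine eq_of_two_mul ?_
  linear_combination h₁ + h₂ + h₃ + 2 * h₄

lemma nabla_xi (X : 𝔛) : P.nabla X P.xi = -P.phi X := by
  have h : P.nabla P.xi P.xi = 0 := P.metric_nondegenerate _ fun Y ↦ by
    have h := P.metric_nabla_xi_sub P.xi Y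
    rw [metric_xi, eta_nabla_xi, metric_xi_left, eta_phi] at h
    linear_combination h
  refine P.eq_of_metric_eq fun Y ↦ ?_
  -- Both arguments are split along the image of `φ` and `ξ`; the `ξ` parts vanish because `∇_ξ ξ =
  -- 0` and `∇_X ξ` is orthogonal to `ξ`.
  conv_lhs => rw [P.eq_phi_phi_add X, P.eq_phi_phi_add Y, nabla_add_left, nabla_smul_left, h,
    smul_zero, add_zero, map_add, map_smul, metric_xi, eta_nabla_xi, metric_nabla_phi_xi]
  rw [metric_phi_phi, eta_phi, map_neg, LinearMap.neg_apply]
  simp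

lemma nablaPhi_eq (X Y : 𝔛) : P.nablaPhi X Y = -(P.metric X Y • P.xi) + P.eta Y • X := by
  -- `u` is the defect of the claimed formula. In terms of it the closedness, skewness, `φ²` and
  -- normality identities all become homogeneous, so the task is linear algebra: `u = 0`.
  let u (X Y Z : 𝔛) : A :=
    P.metric (P.nablaPhi X Y) Z + P.metric X Y * P.eta Z - P.eta Y * P.metric X Z
  have cyc (X Y Z : 𝔛) : u X Y Z + u Y Z X + u Z X Y = 0 := by
    simp only [u]
    linear_combination P.metric_nablaPhi_cyclic X Y Z - P.eta Z * P.metric_symm Y X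
      - P.eta Y * P.metric_symm X Z - P.eta X * P.metric_symm Z Y
  have skew (X Y Z : 𝔛) : u X Y Z = -u X Z Y := by
    simp only [u]
    linear_combination P.metric_nablaPhi_skew X Y Z - P.metric_symm Y (P.nablaPhi X Z)
  have comm (X Y Z : 𝔛) : u X (P.phi Y) Z = u X Y (P.phi Z) := by
    have h := congr(P.metric $(P.nablaPhi_phi X Y) Z)
    simp only [nabla_xi, map_add, map_sub, map_neg, map_smul, LinearMap.add_apply,
      LinearMap.sub_apply, LinearMap.neg_apply, LinearMap.smul_apply, smul_eq_mul, metric_phi_left,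
      metric_xi_left] at h
    simp only [u, eta_phi]
    linear_combination h
  have normal (X Y Z : 𝔛) : u (P.phi X) Y Z - u (P.phi Y) X Z - u Y X (P.phi Z)
      + u X Y (P.phi Z) = 0 := by
    have h := congr(P.metric $(P.nablaPhi_normal X Y) Z)
    simp only [map_add, map_sub, map_smul, LinearMap.add_apply,
      LinearMap.sub_apply, LinearMap.smul_apply, smul_eq_mul, metric_phi_left,
      metric_xi_left] at h
    have h₂ := P.metric_phi_left X Y
    have h₃ := P.metric_symm Y (P.phi X)
    simp only [u, eta_phi, metric_phi_left]
    linear_combination h + P.eta Z * h₂ + P.eta Z * h₃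
  -- `φ` moves freely between the last two slots, in which `u` is skew; the cyclic identity then
  -- turns the normality relation into `2u(Z, Y, φX) = 0`.
  have hphi (Z Y X : 𝔛) : u Z Y (P.phi X) = 0 := by
    have ws (X Y Z : 𝔛) : u X Y (P.phi Z) + u X Z (P.phi Y) = 0 := by
      rw [← comm, skew]; ring
    refine eq_of_two_mul ?_
    linear_combination normal X Y Z - cyc (P.phi X) Y Z + cyc (P.phi Y) X Z + comm Z X Y
      - comm Z Y X + ws Y Z X - ws X Z Y + ws Z X Y
  have hxi (X Y : 𝔛) : u X Y P.xi = 0 := by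
    simp only [u, metric_nablaPhi_skew, nablaPhi_xi, nabla_xi, P.eta_xi, metric_xi, map_neg,
      metric_phi_phi]
    linear_combination P.metric_symm X Y
  refine P.eq_of_metric_eq fun Z ↦ sub_eq_zero.1 ?_
  have hZ : u X Y (P.phi (P.phi Z)) + P.eta Z * u X Y P.xi = u X Y Z := by
    conv_rhs => rw [P.eq_phi_phi_add Z]
    simp only [u, map_add, map_smul, smul_eq_mul]
    ring
  rw [hphi, hxi] at hZ
  simp only [u] at hZ
  simp only [map_add, map_neg, map_smul, LinearMap.add_apply, LinearMap.neg_apply,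
    LinearMap.smul_apply, metric_xi_left, smul_eq_mul]
  linear_combination -hZ

lemma nabla_phi (X Y : 𝔛) : P.nabla X (P.phi Y) =
    P.phi (P.nabla X Y) - P.metric X Y • P.xi + P.eta Y • X := by
  have h := P.nablaPhi_eq X Y
  rw [nablaPhi, sub_eq_iff_eq_add] at h
  rw [h]
  abel

lemma curvature_xi (X Y : 𝔛) : P.curvature X Y P.xi = P.eta X • Y - P.eta Y • X := by
  simp only [curvature_apply, LeviCivitaAlgebra.bracket, nabla_xi, map_neg, nabla_phi,
    map_sub, AddMonoidHom.sub_apply]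
  rw [P.metric_symm Y X]
  module

/-- The commutator of `R(X, Y)` with `φ`, obtained by differentiating `nabla_phi` a second time. -/
lemma curvature_phi (X Y Z : 𝔛) : P.curvature X Y (P.phi Z) = P.phi (P.curvature X Y Z)
    + P.metric Y Z • P.phi X - P.metric X Z • P.phi Y - P.metric (P.phi X) Z • Y
    + P.metric (P.phi Y) Z • X := by
  simp only [curvature_apply, nabla_phi, LeviCivitaAlgebra.bracket, map_sub, map_add, nabla_smul,
    nabla_xi, deriv_metric, deriv_eta, map_neg, LinearMap.neg_apply,
    AddMonoidHom.sub_apply]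
  module

end ParaSasakiAlgebra
end ParaSasaki
end

/-! ### Traces, Ricci identities and closed two-forms -/

noncomputable section

namespace ParaSasaki

namespace LeviCivitaAlgebra

variable {A 𝔛 : Type*} [CommRing A] [Algebra ℝ A] [AddCommGroup 𝔛] [Module A 𝔛]
  (L : LeviCivitaAlgebra A 𝔛)

/-- The covariant derivative `∇_W S` of an endomorphism field. -/
def nablaEnd (W : 𝔛) (S : 𝔛 →ₗ[A] 𝔛) : 𝔛 →ₗ[A] 𝔛 where
  toFun X := L.nabla W (S X) - S (L.nabla W X)
  map_add' X Y := by simp only [map_add]; abel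
  map_smul' f X := by simp only [map_smul, nabla_smul, map_add, RingHom.id_apply]; module

@[simp] lemma nablaEnd_apply (W : 𝔛) (S : 𝔛 →ₗ[A] 𝔛) (X : 𝔛) :
    L.nablaEnd W S X = L.nabla W (S X) - S (L.nabla W X) := rfl

lemma nablaEnd_comp (W : 𝔛) (S T : 𝔛 →ₗ[A] 𝔛) :
    L.nablaEnd W (S ∘ₗ T) = L.nablaEnd W S ∘ₗ T + S ∘ₗ L.nablaEnd W T := by
  ext X; simp

lemma deriv_trace_eq (W : 𝔛) (S : 𝔛 →ₗ[A] 𝔛) :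
    L.deriv W (L.trace S) = L.trace (L.nablaEnd W S) :=
  L.deriv_trace W S _ fun _ ↦ rfl

/-- The second Bianchi identity. -/
lemma second_bianchi (W X Y : 𝔛) :
    (L.nablaEnd W (L.curvature X Y) - L.curvature (L.bracket W X) Y)
      + (L.nablaEnd X (L.curvature Y W) - L.curvature (L.bracket X Y) W)
      + (L.nablaEnd Y (L.curvature W X) - L.curvature (L.bracket Y W) X) = 0 := by
  ext Z
  -- As operators, the double commutators of `∇_W`, `∇_X`, `∇_Y` cancel by themselves; what is left
  -- is `∇` along the Jacobi sum.
  have j := congr(L.nabla $(L.jacobi W X Y) Z)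
  simp only [map_add, map_sub, AddMonoidHom.add_apply, AddMonoidHom.sub_apply, map_zero,
    AddMonoidHom.zero_apply] at j
  simp only [LinearMap.add_apply, LinearMap.sub_apply, nablaEnd_apply, curvature_apply,
    LeviCivitaAlgebra.bracket, map_sub, AddMonoidHom.sub_apply, LinearMap.zero_apply]
  rw [← neg_eq_zero, ← j]
  abel

/-- The differential of a function. -/
def differential (f : A) : 𝔛 →ₗ[A] A where
  toFun X := L.deriv X f
  map_add' X Y := by simp
  map_smul' h X := by simp

@[simp] lemma differential_apply (f : A) (X : 𝔛) : L.differential f X = L.deriv X f := rfl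

end LeviCivitaAlgebra

namespace ParaSasakiAlgebra

open LeviCivitaAlgebra

variable {A 𝔛 : Type*} [CommRing A] [Algebra ℝ A] [AddCommGroup 𝔛] [Module A 𝔛] {n : ℕ}
  (P : ParaSasakiAlgebra A 𝔛 n)

lemma trace_phi : P.trace P.phi = 0 := by
  have h := P.trace_adjoint P.phi (-P.phi) fun X Y ↦ by
    rw [metric_phi_left, LinearMap.neg_apply, map_neg]
  rw [map_neg] at h
  exact eq_of_two_mul (by linear_combination h)

lemma trace_phi_comp_phi : P.trace (P.phi ∘ₗ P.phi) = 2 * n := by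
  have h : P.phi ∘ₗ P.phi = LinearMap.id - P.eta.smulRight P.xi := by
    ext X; simp [P.phi_phi]
  rw [h, map_sub, P.trace_id, P.trace_smulRight, P.eta_xi]
  ring

/-- An algebraic substitute for "`φ` vanishes nowhere": `tr φ² = 2n` is an invertible constant. -/
lemma eq_zero_of_smul_phi (hn : n ≠ 0) {f : A} (h : ∀ X, f • P.phi X = 0) : f = 0 := by
  have h₁ : f • (P.phi ∘ₗ P.phi) = 0 := by ext X; simp [h]
  have h₂ := congr(P.trace $h₁)
  rw [map_smul, trace_phi_comp_phi, map_zero, smul_eq_mul] at h₂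
  exact eq_zero_of_natCast_mul (k := 2 * n) (by simpa) (by push_cast; linear_combination h₂)

lemma ricci_xi (Y : 𝔛) : P.ricci Y P.xi = -(2 * n) * P.eta Y := by
  have h : P.ricciEnd Y P.xi = P.eta.smulRight Y - P.eta Y • LinearMap.id := by
    ext X; simp [curvature_xi]
  rw [ricci, h, map_sub, map_smul, P.trace_id, P.trace_smulRight, smul_eq_mul]
  ring

/-- By pair symmetry the adjoint of `U ↦ R(U, Y)Z` is `U ↦ R(U, Z)Y`, while that of `φ` is `-φ`. -/
lemma trace_phi_comp_ricciEnd_swap (Y Z : 𝔛) :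
    P.trace (P.phi ∘ₗ P.ricciEnd Y Z) = -P.trace (P.phi ∘ₗ P.ricciEnd Z Y) := by
  rw [P.trace_comp_comm _ (P.ricciEnd Z Y), ← map_neg]
  refine P.trace_adjoint _ _ fun U W ↦ ?_
  rw [LinearMap.comp_apply, metric_phi_left, ricciEnd_apply, P.metric_curvature_pair_symm,
    metric_curvature_skew, P.curvature_swap Z]
  simp

lemma ricci_phi (Y Z : 𝔛) : P.ricci Y (P.phi Z) =
    P.trace (P.phi ∘ₗ P.ricciEnd Y Z) - (2 * n - 1) * P.metric Y (P.phi Z) := by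
  have h : P.ricciEnd Y (P.phi Z) = P.phi ∘ₗ P.ricciEnd Y Z + P.metric Y Z • P.phi
      - (P.metric Z).smulRight (P.phi Y) + (P.metric (P.phi Z)).smulRight Y
      + P.metric (P.phi Y) Z • LinearMap.id := by
    ext U
    simp [curvature_phi, metric_phi_left, P.metric_symm Z]
  rw [ricci, h]
  simp only [map_add, map_sub, map_smul, P.trace_smulRight, trace_phi, P.trace_id, smul_eq_mul,
    P.metric_symm Z (P.phi Y), P.metric_symm (P.phi Z) Y, metric_phi_left]
  ring

/-- Both terms of `ricci_phi` are skew. When `S` is symmetric, this says that the Ricci operator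
commutes with `φ`. -/
lemma ricci_phi_skew (Y Z : 𝔛) : P.ricci Y (P.phi Z) = -P.ricci Z (P.phi Y) := by
  rw [ricci_phi, ricci_phi, trace_phi_comp_ricciEnd_swap]
  linear_combination -(2 * n - 1) * P.metric_phi_left Y Z + (2 * n - 1) * P.metric_symm (P.phi Y) Z

/-- The first Bianchi identity writes `R(Y, Z)U` as `R(U, Z)Y - R(U, Y)Z`, reducing the trace to
`ricci_phi`. -/
lemma trace_phi_comp_curvature (Y Z : 𝔛) : P.trace (P.phi ∘ₗ P.curvature Y Z) =
    -2 * (P.ricci Y (P.phi Z) + (2 * n - 1) * P.metric Y (P.phi Z)) := by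
  have h : P.phi ∘ₗ P.curvature Y Z = P.phi ∘ₗ P.ricciEnd Z Y - P.phi ∘ₗ P.ricciEnd Y Z := by
    ext U
    have h := congr(P.phi $(P.bianchi U Y Z))
    rw [P.curvature_swap Z U] at h
    simp only [map_add, map_neg, map_zero] at h
    simp only [LinearMap.comp_apply, LinearMap.sub_apply, ricciEnd_apply]
    rw [← sub_eq_zero, ← h]
    abel
  rw [h, ricci_phi, map_sub, P.trace_phi_comp_ricciEnd_swap Z Y]
  ring

/-- `∇_W φ` is a sum of two rank-one endomorphisms, so the trace is explicit. Its cyclic sum is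
zero. -/
lemma trace_nablaEnd_phi_comp (W X Y : 𝔛) :
    P.trace (P.nablaEnd W P.phi ∘ₗ P.curvature X Y) =
      2 * (P.eta Y * P.metric W X - P.eta X * P.metric W Y) := by
  have h : P.nablaEnd W P.phi ∘ₗ P.curvature X Y =
      (P.eta ∘ₗ P.curvature X Y).smulRight W - (P.metric W ∘ₗ P.curvature X Y).smulRight P.xi := by
    ext Z
    have h := P.nablaPhi_eq W (P.curvature X Y Z)
    rw [nablaPhi] at h
    simp [h]
    abel
  rw [h, map_sub, P.trace_smulRight, P.trace_smulRight, LinearMap.comp_apply,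
    LinearMap.comp_apply, ← metric_xi, metric_curvature_skew, curvature_xi]
  simp only [map_sub, map_smul, smul_eq_mul]
  ring

/-- The trace of `φ R(X, Y)` is a closed form. -/
lemma trace_phi_comp_curvature_closed (W X Y : 𝔛) :
    (P.deriv W (P.trace (P.phi ∘ₗ P.curvature X Y))
        - P.trace (P.phi ∘ₗ P.curvature (P.bracket W X) Y))
      + (P.deriv X (P.trace (P.phi ∘ₗ P.curvature Y W))
        - P.trace (P.phi ∘ₗ P.curvature (P.bracket X Y) W))
      + (P.deriv Y (P.trace (P.phi ∘ₗ P.curvature W X))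
        - P.trace (P.phi ∘ₗ P.curvature (P.bracket Y W) X)) = 0 := by
  -- `tr(φ ∘ ·)` of the second Bianchi identity; the Leibniz terms with `∇φ` cancel cyclically.
  have h := congr(P.trace (P.phi ∘ₗ $(P.second_bianchi W X Y)))
  simp only [LinearMap.comp_add, LinearMap.comp_sub, map_add, map_sub, LinearMap.comp_zero,
    map_zero] at h
  simp only [deriv_trace_eq, nablaEnd_comp, map_add, trace_nablaEnd_phi_comp]
  linear_combination h - 2 * P.eta X * P.metric_symm W Y + 2 * P.eta Y * P.metric_symm W X
    - 2 * P.eta W * P.metric_symm Y X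

/-- Closedness of `Φ` in bracket form, so that it can be subtracted from
`trace_phi_comp_curvature_closed`. -/
lemma fundamentalForm_closed (W X Y : 𝔛) :
    (P.deriv W (P.metric X (P.phi Y)) - P.metric (P.bracket W X) (P.phi Y))
      + (P.deriv X (P.metric Y (P.phi W)) - P.metric (P.bracket X Y) (P.phi W))
      + (P.deriv Y (P.metric W (P.phi X)) - P.metric (P.bracket Y W) (P.phi X)) = 0 := by
  have s (X Y : 𝔛) : P.metric X (P.phi Y) = -P.metric Y (P.phi X) := by
    rw [← metric_phi_left, P.metric_symm]
  simp only [deriv_metric, nabla_phi, LeviCivitaAlgebra.bracket, map_sub, map_add, map_smul,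
    LinearMap.sub_apply, smul_eq_mul, metric_xi]
  linear_combination s X (P.nabla W Y) + s Y (P.nabla X W) + s W (P.nabla Y X)

/-- If `S(X, φY) = α g(X, φY)` on a para-Sasakian manifold of dimension at least five, then `α` is
constant. -/
lemma deriv_eq_zero_of_ricci_phi (hn : 1 < n) {α : A}
    (h : ∀ X Y, P.ricci X (P.phi Y) = α * P.metric X (P.phi Y)) (W : 𝔛) : P.deriv W α = 0 := by
  -- `dα ∧ Φ = 0`, since `Φ` and `(α + 2n - 1)Φ` are both closed.
  have key (W X Y : 𝔛) : P.deriv W α * P.metric X (P.phi Y) + P.deriv X α * P.metric Y (P.phi W)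
      + P.deriv Y α * P.metric W (P.phi X) = 0 := by
    have c : ∀ X, P.deriv X (2 * (n : A) - 1) = 0 := fun X ↦ by
      rw [map_sub, LeviCivitaAlgebra.deriv_mul, deriv_two, LeviCivitaAlgebra.deriv_natCast,
        Derivation.map_one_eq_zero]
      ring
    have h₁ := P.trace_phi_comp_curvature_closed W X Y
    have h₂ := P.fundamentalForm_closed W X Y
    simp only [trace_phi_comp_curvature, h, LeviCivitaAlgebra.deriv_mul, map_add, c, deriv_two,
      map_neg] at h₁
    refine eq_of_two_mul ?_
    linear_combination -h₁ - 2 * (α + 2 * n - 1) * h₂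
  -- At `W = ξ` only `(ξα)Φ` survives, as `ξ` lies in the kernel of `Φ`.
  have hxi : P.deriv P.xi α = 0 := by
    refine P.eq_zero_of_smul_phi (by omega) fun Y ↦ P.metric_nondegenerate _ fun X ↦ ?_
    have := key P.xi X Y
    rw [phi_xi, map_zero, metric_xi_left, eta_phi] at this
    rw [map_smul, LinearMap.smul_apply, smul_eq_mul, P.metric_symm]
    linear_combination this
  obtain ⟨G, hG⟩ := P.exists_metric_eq (P.differential α)
  simp only [differential_apply] at hG
  -- `dα ∧ Φ = 0` at `(W, X, φY)`, read as an identity of endomorphisms in `Y` with `G` the gradient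
  -- of `α`. Its trace is `(2n - 2) dα(W) = 0`, which is where `n > 1` enters.
  have h₁ : P.deriv W α • (P.phi ∘ₗ P.phi) + (P.metric (P.phi W) ∘ₗ P.phi).smulRight G
      - (P.differential α ∘ₗ P.phi).smulRight (P.phi W) = 0 := by
    ext Y
    refine P.eq_of_metric_eq fun X ↦ ?_
    have := key W X (P.phi Y)
    rw [← hG X, P.metric_symm X, P.metric_symm (P.phi Y)] at this
    simp
    linear_combination this - P.deriv (P.phi Y) α * P.metric_phi_left W X
  have h₂ := congr(P.trace $h₁)
  simp only [map_add, map_sub, map_smul, P.trace_smulRight, trace_phi_comp_phi, map_zero,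
    LinearMap.comp_apply, smul_eq_mul, P.compatible, differential_apply, P.phi_phi] at h₂
  rw [P.metric_symm W, hG, ← P.metric_xi G, hG, hxi] at h₂
  refine eq_zero_of_natCast_mul (k := 2 * (n - 1)) (by omega) ?_
  rw [Nat.cast_mul, Nat.cast_sub hn.le]
  push_cast
  linear_combination h₂

end ParaSasakiAlgebra
end ParaSasaki
end

/-! ### Solitons with a contact potential field -/

noncomputable section

namespace ParaSasaki
namespace ParaSasakiAlgebra

open LeviCivitaAlgebra

variable {A 𝔛 : Type*} [CommRing A] [Algebra ℝ A] [AddCommGroup 𝔛] [Module A 𝔛] {n : ℕ}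
  (P : ParaSasakiAlgebra A 𝔛 n)

/-- The Lie derivative `L_V g`. -/
def lieMetric (V X Y : 𝔛) : A := P.deriv V (P.metric X Y) - P.metric (P.bracket V X) Y
  - P.metric X (P.bracket V Y)

/-- The Lie derivative `L_V φ`. -/
def liePhi (V X : 𝔛) : 𝔛 := P.bracket V (P.phi X) - P.phi (P.bracket V X)

/-- `V` is an infinitesimal contact transformation: `L_V η = a η`. -/
def IsContact (V : 𝔛) (a : A) : Prop :=
  ∀ X, P.deriv V (P.eta X) - P.eta (P.bracket V X) = a * P.eta X

/-- The soliton equation `L_V g + 2 S + 2 λ g + 2 μ η ⊗ η = 0`. -/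
def IsSoliton (V : 𝔛) (lam mu : A) : Prop :=
  ∀ X Y, P.lieMetric V X Y + 2 * P.ricci X Y + 2 * lam * P.metric X Y
    + 2 * mu * (P.eta X * P.eta Y) = 0

variable {P} {V : 𝔛} {a lam mu : A}

/-- Every other term of the soliton equation is symmetric. -/
lemma IsSoliton.ricci_symm (h : P.IsSoliton V lam mu) (X Y : 𝔛) : P.ricci X Y = P.ricci Y X := by
  have h₁ := h X Y
  have h₂ := h Y X
  have h₃ : P.lieMetric V X Y = P.lieMetric V Y X := by
    simp only [lieMetric]
    rw [P.metric_symm X Y, P.metric_symm (P.bracket V X), P.metric_symm X (P.bracket V Y)]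
    ring
  exact eq_of_two_mul (by linear_combination h₁ - h₂ - h₃ - 2 * lam * P.metric_symm X Y)

/-- As `S(ξ, ·) = -2n η`, the soliton equation at `ξ` makes `[V, ξ]` a multiple of `ξ`. The contact
equation at `ξ` identifies the coefficient as `-a`, and comparing the two values gives `a`. -/
lemma bracket_xi (hs : P.IsSoliton V lam mu) (hV : P.IsContact V a) :
    P.bracket V P.xi = -a • P.xi ∧ a = 2 * n - lam - mu := by
  have h₁ : P.bracket V P.xi = (a - 4 * n + 2 * lam + 2 * mu) • P.xi :=
    P.eq_of_metric_eq fun X ↦ by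
      have h := hs P.xi X
      rw [hs.ricci_symm, ricci_xi, metric_xi_left, P.eta_xi, lieMetric, metric_xi_left,
        metric_xi_left] at h
      rw [map_smul, LinearMap.smul_apply, metric_xi_left, smul_eq_mul]
      linear_combination hV X - h
  have h₂ : a - 4 * n + 2 * lam + 2 * mu = -a := by
    have h := hV P.xi
    rw [h₁, map_smul, P.eta_xi, Derivation.map_one_eq_zero, smul_eq_mul] at h
    linear_combination -h
  exact ⟨by rw [h₁, h₂], eq_of_two_mul (by linear_combination h₂)⟩

/-- `L_V(φ²) = -L_V(η ⊗ ξ) = 0`, because `L_V η = aη` and `L_V ξ = -aξ` cancel. -/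
lemma liePhi_phi (hs : P.IsSoliton V lam mu) (hV : P.IsContact V a) (X : 𝔛) :
    P.liePhi V (P.phi X) = -P.phi (P.liePhi V X) := by
  have h₁ : P.bracket V (P.phi (P.phi X)) = P.bracket V X
      - P.eta X • P.bracket V P.xi - P.deriv V (P.eta X) • P.xi := by
    simp only [P.phi_phi, LeviCivitaAlgebra.bracket, map_sub, AddMonoidHom.sub_apply,
      nabla_smul, nabla_smul_left]
    module
  have h₂ := hV X
  rw [sub_eq_iff_eq_add] at h₂
  rw [liePhi, h₁, (bracket_xi hs hV).1, h₂, liePhi, map_sub, P.phi_phi (P.bracket V X)]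
  module

/-- The Lie derivative of `dη` along an infinitesimal contact transformation. -/
lemma IsContact.lieMetric_phi (hV : P.IsContact V a) (X Y : 𝔛) :
    2 * (P.lieMetric V X (P.phi Y) + P.metric X (P.liePhi V Y)) =
      P.deriv X a * P.eta Y - P.deriv Y a * P.eta X + 2 * a * P.metric X (P.phi Y) := by
  have pc (X Y : 𝔛) : P.deriv X (P.eta Y) - P.deriv Y (P.eta X) - P.eta (P.bracket X Y) =
    2 * P.metric X (P.phi Y) := P.paracontact X Y
  -- `L_V` commutes with `d`: `h₁`, `h₂`, `h₃` expand `L_V` of `dη = Φ`, while `hX`, `hY`, `hb` and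
  -- Jacobi give `d(aη) = da ∧ η + a dη`.
  have h₁ := congr(P.deriv V $(pc X Y))
  have h₂ := pc (P.bracket V X) Y
  have h₃ := pc X (P.bracket V Y)
  have hX := congr(P.deriv Y $(hV X))
  have hY := congr(P.deriv X $(hV Y))
  have hb := hV (P.bracket X Y)
  have j : P.eta (P.bracket V (P.bracket X Y)) + P.eta (P.bracket X (P.bracket Y V)) +
      P.eta (P.bracket Y (P.bracket V X)) = 0 := by
    rw [← map_add, ← map_add]
    exact (congrArg P.eta (P.jacobi V X Y)).trans (map_zero _)
  have sw (X Y : 𝔛) : P.bracket X Y = -P.bracket Y X := by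
    simp [LeviCivitaAlgebra.bracket]
  rw [sw Y V, sw X (-_), sw Y (P.bracket V X)] at j
  rw [sw X (P.bracket V Y)] at h₃
  have e : P.bracket (-P.bracket V Y) X = -P.bracket (P.bracket V Y) X := by
    simp [LeviCivitaAlgebra.bracket]
    abel
  rw [e] at j
  simp only [map_sub, LeviCivitaAlgebra.deriv_mul, deriv_bracket, deriv_two, map_neg]
    at h₁ h₂ h₃ hX hY j
  simp only [lieMetric, liePhi, map_sub]
  linear_combination -h₁ + h₂ + h₃ - hX + hY - hb - j + a * pc X Y

/-- Setting `Y = ξ` in `lieMetric_phi` gives `da = (ξa)η`. On fields in `ker η` the identity `d(da)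
= 0` then reads `(ξa) dη = 0`. -/
lemma IsContact.deriv_eq_zero (hs : P.IsSoliton V lam mu) (hV : P.IsContact V a) (hn : n ≠ 0)
    (X : 𝔛) : P.deriv X a = 0 := by
  have h (X : 𝔛) : P.deriv X a = P.deriv P.xi a * P.eta X := by
    have h := hV.lieMetric_phi X P.xi
    have h₁ : P.liePhi V P.xi = 0 := by
      rw [liePhi, (bracket_xi hs hV).1, map_smul, phi_xi, smul_zero, sub_zero]
      simp [LeviCivitaAlgebra.bracket]
    rw [h₁, phi_xi, P.eta_xi, lieMetric] at h
    simp [LeviCivitaAlgebra.bracket] at h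
    linear_combination -h
  rw [h, P.eq_zero_of_smul_phi hn (f := P.deriv P.xi a) fun Y ↦ ?_, zero_mul]
  refine P.metric_nondegenerate _ fun Z ↦ eq_of_two_mul ?_
  set ρ := P.deriv P.xi a
  -- `φ²` projects onto `ker η`, so `a` has zero derivative along both fields and only the bracket
  -- contributes.
  have h₁ := P.deriv_bracket (P.phi (P.phi Z)) (P.phi (P.phi Y)) a
  have h₂ := P.paracontact (P.phi (P.phi Z)) (P.phi (P.phi Y))
  rw [h, h (P.phi (P.phi Y)), h (P.phi (P.phi Z))] at h₁
  simp only [eta_phi, mul_zero, map_zero, sub_zero] at h₁ h₂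
  rw [phi_phi_phi, P.metric_symm, metric_phi_phi, eta_phi] at h₂
  rw [map_smul, LinearMap.smul_apply, smul_eq_mul]
  rw [LeviCivitaAlgebra.bracket] at h₁
  linear_combination -ρ * h₂ - h₁

/-- The structure theorem for almost `η`-Ricci solitons whose potential field is an infinitesimal
contact transformation. -/
theorem IsSoliton.rigidity (hn : 1 < n) (hs : P.IsSoliton V lam mu) (hV : P.IsContact V a) :
    (∀ X, P.deriv X a = 0) ∧ (∀ X, P.deriv X lam = 0) ∧ (∀ X, P.deriv X mu = 0) ∧
    (∀ X, P.liePhi V X = 0) ∧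
    ∀ X Y, 2 * P.ricci X Y = -(2 * lam + a) * P.metric X Y
      + (2 * lam + a - 4 * n) * (P.eta X * P.eta Y) := by
  have ha := hV.deriv_eq_zero hs (by omega)
  have hL (X Y : 𝔛) : P.metric X (P.liePhi V Y) =
      2 * P.ricci X (P.phi Y) + (2 * lam + a) * P.metric X (P.phi Y) := by
    have h₁ := hV.lieMetric_phi X Y
    have h₂ := hs X (P.phi Y)
    rw [ha, ha] at h₁
    rw [eta_phi] at h₂
    exact eq_of_two_mul (by linear_combination h₁ - 2 * h₂)
  -- In `hL` the left operator anticommutes with `φ` and the right one commutes with it. Comparing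
  -- `hL` at `(X, φY)` and `(φX, Y)` makes the right side equal to its own negative.
  have hR (X Y : 𝔛) : 2 * P.ricci X (P.phi (P.phi Y)) =
      -(2 * lam + a) * P.metric X (P.phi (P.phi Y)) := by
    have h₁ := hL X (P.phi Y)
    have h₂ := hL (P.phi X) Y
    have h₄ := P.ricci_phi_skew X (P.phi Y)
    have h₅ := hs.ricci_symm (P.phi X) (P.phi Y)
    have h₆ := P.metric_phi_left X (P.phi Y)
    have h₇ := P.metric_phi_left X (P.liePhi V Y)
    rw [liePhi_phi hs hV, map_neg] at h₁
    refine eq_of_two_mul ?_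
    linear_combination -h₁ + h₂ - h₇ + 2 * h₄ + 2 * h₅ + (2 * lam + a) * h₆
  have hφ (X Y : 𝔛) : 2 * P.ricci X (P.phi Y) = -(2 * lam + a) * P.metric X (P.phi Y) := by
    have := hR X (P.phi Y)
    rwa [phi_phi_phi] at this
  have hlam (X : 𝔛) : P.deriv X lam = 0 := by
    have ha₂ : (2 : A) * ((1 / 2 : ℝ) • a) = a := by
      rw [mul_smul_comm, two_mul, ← two_smul ℝ, smul_smul]
      norm_num
    have h := P.deriv_eq_zero_of_ricci_phi hn (α := -(lam + (1 / 2 : ℝ) • a)) (fun X Y ↦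
      eq_of_two_mul (by linear_combination hφ X Y + P.metric X (P.phi Y) * ha₂)) X
    rwa [map_neg, map_add, Derivation.map_smul, ha, smul_zero, add_zero, neg_eq_zero] at h
  refine ⟨ha, hlam, fun X ↦ ?_, fun X ↦ P.metric_nondegenerate _ fun Y ↦ ?_, fun X Y ↦ ?_⟩
  · have h := congr(P.deriv X $((bracket_xi hs hV).2))
    rw [ha, map_sub, map_sub, hlam, LeviCivitaAlgebra.deriv_mul, deriv_two,
      LeviCivitaAlgebra.deriv_natCast] at h
    linear_combination h
  · rw [P.metric_symm, hL]
    linear_combination hφ Y X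
  · have h := hR X Y
    -- The `φ²` part of `S` comes from `hR`, the `ξ` part from `ricci_xi`.
    have e : P.ricci X Y = P.ricci X (P.phi (P.phi Y)) + P.eta Y * P.ricci X P.xi := by
      conv_lhs => rw [P.eq_phi_phi_add Y, ricci_add_right, ricci_smul_right]
    rw [P.metric_phi_phi] at h
    rw [e, ricci_xi]
    linear_combination h

end ParaSasakiAlgebra
end ParaSasaki
end

/-! ### Smooth functions, smooth fields and traces -/

noncomputable section

namespace ParaSasaki

section SmoothFields

variable (E : Type*) [NormedAddCommGroup E] [NormedSpace ℝ E]
  (M : Type*) [TopologicalSpace M] [ChartedSpace E M]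

/-- The algebra of smooth functions on `M`. -/
def smoothFunctions : Subalgebra ℝ (M → ℝ) where
  carrier := {f | ContMDiff 𝓘(ℝ, E) 𝓘(ℝ) ∞ f}
  mul_mem' hf hg := ContMDiff.mul hf hg
  add_mem' hf hg := ContMDiff.add hf hg
  algebraMap_mem' _ := contMDiff_const

variable {E M} in
lemma smoothFunctions_sum_apply {ι : Type*} (s : Finset ι) (f : ι → smoothFunctions E M) (x : M) :
    (∑ i ∈ s, f i).1 x = ∑ i ∈ s, (f i).1 x := by
  rw [AddSubmonoidClass.coe_finsetSum, Finset.sum_apply]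

variable [IsManifold 𝓘(ℝ, E) ∞ M]

/-- The group of smooth vector fields on `M`. -/
def smoothFields : AddSubgroup (Π x : M, TangentSpace 𝓘(ℝ, E) x) where
  carrier := {X | IsSmoothField X}
  add_mem' hX hY := ContMDiff.add_section hX hY
  zero_mem' := (contMDiff_zeroSection ℝ (TangentSpace 𝓘(ℝ, E) : M → Type _))
  neg_mem' hX := ContMDiff.neg_section hX

variable {E M}

instance : SMul (smoothFunctions E M) (smoothFields E M) :=
  ⟨fun f X ↦ ⟨fun x ↦ f.1 x • X.1 x, ContMDiff.smul_section f.2 X.2⟩⟩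

lemma smoothFields_smul_apply (f : smoothFunctions E M) (X : smoothFields E M) (x : M) :
    (f • X).1 x = f.1 x • X.1 x := rfl

lemma smoothFields_add_apply (X Y : smoothFields E M) (x : M) :
    (X + Y).1 x = X.1 x + Y.1 x := rfl

instance : Module (smoothFunctions E M) (smoothFields E M) where
  one_smul X := Subtype.ext (funext fun x ↦ one_smul ℝ (X.1 x))
  mul_smul f h X := Subtype.ext (funext fun x ↦ mul_smul (f.1 x) (h.1 x) (X.1 x))
  smul_zero f := Subtype.ext (funext fun x ↦ smul_zero (f.1 x))
  smul_add f X Y := Subtype.ext (funext fun x ↦ smul_add (f.1 x) (X.1 x) (Y.1 x))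
  add_smul f h X := Subtype.ext (funext fun x ↦ add_smul (f.1 x) (h.1 x) (X.1 x))
  zero_smul X := Subtype.ext (funext fun x ↦ zero_smul ℝ (X.1 x))

lemma smoothFields_sum_apply {ι : Type*} (s : Finset ι) (X : ι → smoothFields E M) (x : M) :
    (∑ i ∈ s, X i).1 x = ∑ i ∈ s, (X i).1 x := by
  rw [AddSubmonoidClass.coe_finsetSum, Finset.sum_apply]

variable (E) in
/-- A system of smooth vector fields, which is a frame near `x`, together with its coframe, all
cut off away from `x`. -/
structure CutoffFrame (x : M) where
  cutoff : smoothFunctions E M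
  cutoff_eventually : ∀ᶠ y in 𝓝 x, cutoff.1 y = 1
  frame : Fin (finrank ℝ E) → smoothFields E M
  coframe : Fin (finrank ℝ E) → smoothFields E M →ₗ[smoothFunctions E M] smoothFunctions E M
  sum_coframe_smul (X : smoothFields E M) :
    ∑ i, coframe i X • frame i = (cutoff * cutoff) • X
  linearIndependent : LinearIndependent ℝ fun i ↦ (frame i).1 x

lemma CutoffFrame.cutoff_self {x : M} (F : CutoffFrame E x) : F.cutoff.1 x = 1 :=
  F.cutoff_eventually.self_of_nhds

/-- Up to the factor `χ²` every endomorphism field is a finite sum of rank-one ones, so trace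
identities need checking only on those. -/
lemma CutoffFrame.sum_smulRight {x : M} (F : CutoffFrame E x)
    (T : smoothFields E M →ₗ[smoothFunctions E M] smoothFields E M) :
    ∑ i, (F.coframe i).smulRight (T (F.frame i)) = (F.cutoff * F.cutoff) • T := by
  ext1 X
  simp only [LinearMap.sum_apply, LinearMap.smulRight_apply, LinearMap.smul_apply]
  rw [← map_smul, ← F.sum_coframe_smul X, map_sum]
  simp only [map_smul]

variable [FiniteDimensional ℝ E] [T2Space M]

variable (E) in
/-- Smooth vector fields can be cut off away from a point. -/
lemma exists_cutoffFrame (x : M) : Nonempty (CutoffFrame E x) := by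
  let χ : SmoothBumpFunction 𝓘(ℝ, E) x := Classical.arbitrary _
  let e := trivializationAt E (TangentSpace 𝓘(ℝ, E) : M → Type _) x
  let b := finBasis ℝ E
  have he : e.baseSet = (chartAt E x).source := TangentBundle.trivializationAt_baseSet x
  have hx : x ∈ e.baseSet := FiberBundle.mem_baseSet_trivializationAt' x
  have hχ : tsupport χ ⊆ e.baseSet := he ▸ χ.tsupport_subset_chartAt_source
  refine ⟨{
    cutoff := ⟨χ, χ.contMDiff⟩
    cutoff_eventually := χ.eventuallyEq_one
    frame i := ⟨(χ : M → ℝ) • e.localFrame b i, ContMDiffOn.smul_section_of_tsupport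
      χ.contMDiff.contMDiffOn e.open_baseSet hχ (e.contMDiffOn_localFrame_baseSet ∞ b i)⟩
    coframe i :=
      { toFun X := ⟨fun y ↦ χ y • e.localFrameCoeff 𝓘(ℝ, E) b i y (X.1 y), χ.contMDiff_smul (he ▸
          contMDiffOn_baseSet_localFrameCoeff b X.2.contMDiffOn i)⟩
        map_add' X Y := by
          ext y
          change χ y • e.localFrameCoeff 𝓘(ℝ, E) b i y (X.1 y + Y.1 y) =
            χ y • e.localFrameCoeff 𝓘(ℝ, E) b i y (X.1 y) +
            χ y • e.localFrameCoeff 𝓘(ℝ, E) b i y (Y.1 y)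
          rw [map_add, smul_add]
        map_smul' f X := by
          ext y
          change χ y • e.localFrameCoeff 𝓘(ℝ, E) b i y (f.1 y • X.1 y) =
            f.1 y * (χ y • e.localFrameCoeff 𝓘(ℝ, E) b i y (X.1 y))
          rw [map_smul, smul_eq_mul, smul_eq_mul, smul_eq_mul]
          ring }
    sum_coframe_smul := fun X ↦ by
      refine Subtype.ext (funext fun y ↦ ?_)
      rw [smoothFields_sum_apply]
      change ∑ i, (χ y • e.localFrameCoeff 𝓘(ℝ, E) b i y (X.1 y)) • (χ y • e.localFrame b i y) =
        (χ y * χ y) • X.1 y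
      by_cases hy : y ∈ e.baseSet
      · conv_rhs => rw [Trivialization.eq_sum_localFrameCoeff_smul (I := 𝓘(ℝ, E)) (e := e)
          (b := b) (s := X.1) hy]
        rw [Finset.smul_sum]
        refine Finset.sum_congr rfl fun i _ ↦ ?_
        rw [smul_smul, smul_smul, smul_eq_mul]
        congr 1
        ring
      · have : χ y = 0 := by
          by_contra h
          exact hy (he ▸ χ.support_subset_source h)
        simp [this]
    linearIndependent := by
      have h := (e.isLocalFrameOn_localFrame_baseSet 𝓘(ℝ, E) 1 b).linearIndependent hx
      have h' : (fun i ↦ ((χ : M → ℝ) • e.localFrame b i) x) = fun i ↦ e.localFrame b i x := by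
        ext1 i
        change χ x • e.localFrame b i x = _
        rw [χ.eq_one, one_smul]
      exact h'.symm ▸ h }⟩

/-- `curvatureAt` uses extensions that need not be globally smooth. Agreement near `x`, not just at
`x`, is required because they are differentiated. -/
lemma exists_smoothField_eventuallyEq_extend {x : M} (v : TangentSpace 𝓘(ℝ, E) x) :
    ∃ X : smoothFields E M, ∀ᶠ y in 𝓝 x, X.1 y = FiberBundle.extend E v y := by
  let χ : SmoothBumpFunction 𝓘(ℝ, E) x := Classical.arbitrary _
  let e := trivializationAt E (TangentSpace 𝓘(ℝ, E) : M → Type _) x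
  have h : ContMDiffOn 𝓘(ℝ, E) (𝓘(ℝ, E).prod 𝓘(ℝ, E)) ∞
      (fun y ↦ (TotalSpace.mk y (FiberBundle.extend E v y) : TangentBundle 𝓘(ℝ, E) M))
      e.baseSet := by
    rw [e.contMDiffOn_section_baseSet_iff]
    refine (contMDiffOn_const (c := (e ⟨x, v⟩).2)).congr fun y hy ↦ ?_
    rw [FiberBundle.extend, e.apply_mk_symm hy]
  refine ⟨⟨(χ : M → ℝ) • FiberBundle.extend E v, ContMDiffOn.smul_section_of_tsupport
    χ.contMDiff.contMDiffOn e.open_baseSet χ.tsupport_subset_chartAt_source h⟩, ?_⟩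
  filter_upwards [χ.eventuallyEq_one] with y hy
  have h' : χ y • FiberBundle.extend E v y = FiberBundle.extend E v y := by
    rw [hy, Pi.one_apply, one_smul]
  exact h'

lemma exists_smoothField_apply_eq {x : M} (v : TangentSpace 𝓘(ℝ, E) x) :
    ∃ X : smoothFields E M, X.1 x = v :=
  (exists_smoothField_eventuallyEq_extend v).imp fun _ h ↦ by
    rw [h.self_of_nhds, FiberBundle.extend_apply_self]

/-- A `C^∞(M)`-linear operation on smooth vector fields is tensorial. -/
lemma map_apply_eq_zero {N W : Type*} [AddCommGroup N] [Module (smoothFunctions E M) N]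
    [AddCommGroup W] [Module ℝ W] {x : M} (l : smoothFields E M →ₗ[smoothFunctions E M] N)
    (ev : N →+ W) (hev : ∀ (f : smoothFunctions E M) n, ev (f • n) = f.1 x • ev n)
    {X : smoothFields E M} (hX : X.1 x = 0) : ev (l X) = 0 := by
  obtain ⟨F⟩ := exists_cutoffFrame E x
  -- Independence of the frame at `x` makes the coefficients of `X` vanish there; linearity carries
  -- this to `l X`.
  have hc (i) : (F.coframe i X).1 x = 0 := by
    have h := congr($(F.sum_coframe_smul X).1 x)
    rw [smoothFields_sum_apply, smoothFields_smul_apply, hX, smul_zero] at h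
    exact Fintype.linearIndependent_iff.1 F.linearIndependent _ h i
  have h := congr(ev (l $(F.sum_coframe_smul X)))
  rw [map_sum, map_sum, map_smul, hev] at h
  have h₁ : (F.cutoff * F.cutoff).1 x = 1 := by
    change F.cutoff.1 x * F.cutoff.1 x = 1
    rw [F.cutoff_self, one_mul]
  rw [h₁, one_smul] at h
  rw [← h]
  exact Finset.sum_eq_zero fun i _ ↦ by rw [map_smul, hev, hc, zero_smul]

lemma end_apply_eq {x : M} (T : smoothFields E M →ₗ[smoothFunctions E M] smoothFields E M)
    {X Y : smoothFields E M} (h : X.1 x = Y.1 x) : (T X).1 x = (T Y).1 x := by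
  have := map_apply_eq_zero (x := x) T
    ((Pi.evalAddMonoidHom _ x).comp (smoothFields E M).subtype) (fun f X ↦ rfl)
    (X := X - Y) (sub_eq_zero.2 h)
  rw [map_sub] at this
  exact sub_eq_zero.1 this

lemma functional_apply_eq {x : M}
    (l : smoothFields E M →ₗ[smoothFunctions E M] smoothFunctions E M)
    {X Y : smoothFields E M} (h : X.1 x = Y.1 x) : (l X).1 x = (l Y).1 x := by
  have := map_apply_eq_zero (x := x) l
    ((Pi.evalAddMonoidHom _ x).comp (smoothFunctions E M).val.toAddMonoidHom) (fun f X ↦ rfl)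
    (X := X - Y) (sub_eq_zero.2 h)
  rw [map_sub] at this
  exact sub_eq_zero.1 this

/-- A smooth vector field with prescribed value at a point. -/
def fieldExtension {x : M} (v : TangentSpace 𝓘(ℝ, E) x) : smoothFields E M :=
  (exists_smoothField_apply_eq v).choose

@[simp] lemma fieldExtension_apply {x : M} (v : TangentSpace 𝓘(ℝ, E) x) :
    (fieldExtension v).1 x = v := (exists_smoothField_apply_eq v).choose_spec

/-- The endomorphism of the tangent space given by a `C^∞(M)`-linear endomorphism of the module of
vector fields. -/
def evalEnd (x : M) (T : smoothFields E M →ₗ[smoothFunctions E M] smoothFields E M) :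
    TangentSpace 𝓘(ℝ, E) x →ₗ[ℝ] TangentSpace 𝓘(ℝ, E) x where
  toFun v := (T (fieldExtension v)).1 x
  map_add' v w := by
    rw [← smoothFields_add_apply, ← map_add]
    exact end_apply_eq T (by simp [smoothFields_add_apply])
  map_smul' c v := by
    have h : (T (algebraMap ℝ (smoothFunctions E M) c • fieldExtension v)).1 x =
      c • (T (fieldExtension v)).1 x := by rw [map_smul]; rfl
    rw [RingHom.id_apply, ← h]
    refine end_apply_eq T ?_
    rw [smoothFields_smul_apply, fieldExtension_apply, fieldExtension_apply]
    rfl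

lemma evalEnd_apply (x : M) (T : smoothFields E M →ₗ[smoothFunctions E M] smoothFields E M)
    (X : smoothFields E M) : evalEnd x T (X.1 x) = (T X).1 x :=
  end_apply_eq T (fieldExtension_apply _)

/-- The functional on the tangent space given by a `C^∞(M)`-linear functional on the module of
vector fields. -/
def evalFunctional (x : M)
    (l : smoothFields E M →ₗ[smoothFunctions E M] smoothFunctions E M) :
    TangentSpace 𝓘(ℝ, E) x →ₗ[ℝ] ℝ where
  toFun v := (l (fieldExtension v)).1 x
  map_add' v w := by
    have h : (l (fieldExtension v + fieldExtension w)).1 x =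
      (l (fieldExtension v)).1 x + (l (fieldExtension w)).1 x := by rw [map_add]; rfl
    rw [← h]
    exact functional_apply_eq l (by simp [smoothFields_add_apply])
  map_smul' c v := by
    have h : (l (algebraMap ℝ (smoothFunctions E M) c • fieldExtension v)).1 x =
      c • (l (fieldExtension v)).1 x := by rw [map_smul]; rfl
    rw [RingHom.id_apply, ← h]
    refine functional_apply_eq l ?_
    rw [smoothFields_smul_apply, fieldExtension_apply, fieldExtension_apply]
    rfl

lemma evalFunctional_apply (x : M)
    (l : smoothFields E M →ₗ[smoothFunctions E M] smoothFunctions E M) (X : smoothFields E M) :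
    evalFunctional x l (X.1 x) = (l X).1 x :=
  functional_apply_eq l (fieldExtension_apply _)

lemma evalEnd_smul (x : M) (f : smoothFunctions E M)
    (T : smoothFields E M →ₗ[smoothFunctions E M] smoothFields E M) :
    evalEnd x (f • T) = f.1 x • evalEnd x T := rfl

lemma evalEnd_sum (x : M) {ι : Type*} (s : Finset ι)
    (T : ι → smoothFields E M →ₗ[smoothFunctions E M] smoothFields E M) :
    evalEnd x (∑ i ∈ s, T i) = ∑ i ∈ s, evalEnd x (T i) := by
  ext v
  change ((∑ i ∈ s, T i) (fieldExtension v)).1 x = _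
  rw [LinearMap.sum_apply, smoothFields_sum_apply, LinearMap.sum_apply]
  rfl

lemma evalEnd_smulRight (x : M)
    (l : smoothFields E M →ₗ[smoothFunctions E M] smoothFunctions E M) (Y : smoothFields E M) :
    evalEnd x (l.smulRight Y) = (evalFunctional x l).smulRight (Y.1 x) := rfl

instance (x : M) : FiniteDimensional ℝ (TangentSpace 𝓘(ℝ, E) x) :=
  inferInstanceAs (FiniteDimensional ℝ E)

/-- The left side is a smooth function; where the cutoff is `1` it is the pointwise trace, which is
therefore smooth. -/
lemma CutoffFrame.trace_evalEnd {x : M} (F : CutoffFrame E x)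
    (T : smoothFields E M →ₗ[smoothFunctions E M] smoothFields E M) (y : M) :
    (∑ i, F.coframe i (T (F.frame i))).1 y =
      (F.cutoff * F.cutoff).1 y * LinearMap.trace ℝ _ (evalEnd y T) := by
  rw [← smul_eq_mul, ← map_smul, ← evalEnd_smul, ← F.sum_smulRight, evalEnd_sum, map_sum,
    smoothFunctions_sum_apply]
  refine Finset.sum_congr rfl fun i _ ↦ ?_
  rw [evalEnd_smulRight, LinearMap.trace_smulRight, evalFunctional_apply]

/-- The trace of an endomorphism field. -/
def fieldTrace : (smoothFields E M →ₗ[smoothFunctions E M] smoothFields E M)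
    →ₗ[smoothFunctions E M] smoothFunctions E M where
  toFun T := ⟨fun x ↦ LinearMap.trace ℝ _ (evalEnd x T), fun x ↦ by
    obtain ⟨F⟩ := exists_cutoffFrame E x
    refine ((∑ i, F.coframe i (T (F.frame i))).2 x).congr_of_eventuallyEq ?_
    filter_upwards [F.cutoff_eventually] with y hy
    have h := F.trace_evalEnd T y
    change _ = F.cutoff.1 y * F.cutoff.1 y * _ at h
    rw [hy, one_mul, one_mul] at h
    exact h.symm⟩
  map_add' S T := Subtype.ext (funext fun x ↦ by
    change LinearMap.trace ℝ (TangentSpace 𝓘(ℝ, E) x) (evalEnd x S + evalEnd x T) =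
      LinearMap.trace ℝ (TangentSpace 𝓘(ℝ, E) x) (evalEnd x S) +
      LinearMap.trace ℝ (TangentSpace 𝓘(ℝ, E) x) (evalEnd x T)
    rw [map_add])
  map_smul' f T := Subtype.ext (funext fun x ↦ by
    change LinearMap.trace ℝ (TangentSpace 𝓘(ℝ, E) x) (f.1 x • evalEnd x T) =
      f.1 x * LinearMap.trace ℝ (TangentSpace 𝓘(ℝ, E) x) (evalEnd x T)
    rw [map_smul, smul_eq_mul])

lemma fieldTrace_apply (T : smoothFields E M →ₗ[smoothFunctions E M] smoothFields E M) (x : M) :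
    (fieldTrace T).1 x = LinearMap.trace ℝ _ (evalEnd x T) := rfl

lemma fieldTrace_smulRight
    (l : smoothFields E M →ₗ[smoothFunctions E M] smoothFunctions E M) (Y : smoothFields E M) :
    fieldTrace (l.smulRight Y) = l Y := by
  ext x
  rw [fieldTrace_apply, evalEnd_smulRight, LinearMap.trace_smulRight, evalFunctional_apply]

lemma fieldTrace_comp_comm (S T : smoothFields E M →ₗ[smoothFunctions E M] smoothFields E M) :
    fieldTrace (S ∘ₗ T) = fieldTrace (T ∘ₗ S) := by
  have h (x : M) (S T : smoothFields E M →ₗ[smoothFunctions E M] smoothFields E M) :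
      evalEnd x (S ∘ₗ T) = evalEnd x S * evalEnd x T :=
    LinearMap.ext fun v ↦ (evalEnd_apply x S _).symm
  ext x
  rw [fieldTrace_apply, fieldTrace_apply, h, h, LinearMap.trace_mul_comm]

lemma fieldTrace_id : fieldTrace (LinearMap.id : smoothFields E M →ₗ[smoothFunctions E M] _) =
    (finrank ℝ E : smoothFunctions E M) := by
  have h (x : M) : evalEnd x (LinearMap.id : smoothFields E M →ₗ[smoothFunctions E M] _) =
      LinearMap.id := LinearMap.ext fun v ↦ fieldExtension_apply v
  ext x
  rw [fieldTrace_apply, h, LinearMap.trace_id]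
  rfl

end SmoothFields
end ParaSasaki
end

/-! ### Derivations, brackets and the Levi-Civita connection on smooth fields -/

noncomputable section

namespace ParaSasaki

section FieldCalculus

variable {E : Type*} [NormedAddCommGroup E] [NormedSpace ℝ E]
  {M : Type*} [TopologicalSpace M] [ChartedSpace E M] [IsManifold 𝓘(ℝ, E) ∞ M]

lemma smoothFields_ext {X Y : smoothFields E M} (h : ∀ x, X.1 x = Y.1 x) : X = Y :=
  Subtype.ext (funext h)

lemma smoothFields_mdifferentiableAt (X : smoothFields E M) (x : M) : MDiffAt (T% X.1) x :=
  (X.2 x).mdifferentiableAt (by simp)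

omit [IsManifold 𝓘(ℝ, E) ∞ M] in
lemma smoothFunctions_mdifferentiableAt (f : smoothFunctions E M) (x : M) : MDiffAt f.1 x :=
  (f.2 x).mdifferentiableAt (by simp)

lemma contMDiff_dirDeriv {X : Π x : M, TangentSpace 𝓘(ℝ, E) x} (hX : IsSmoothField X) {f : M → ℝ}
    (hf : ContMDiff 𝓘(ℝ, E) 𝓘(ℝ) ∞ f) : ContMDiff 𝓘(ℝ, E) 𝓘(ℝ) ∞ (dirDeriv X f) := by
  have h := (hf.contMDiff_tangentMap (m := ∞) le_rfl).comp hX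
  exact contMDiff_snd_tangentBundle_modelSpace ℝ 𝓘(ℝ) |>.comp h

lemma contMDiff_pair (g : PseudoMetric E M) {X Y : Π x : M, TangentSpace 𝓘(ℝ, E) x}
    (hX : IsSmoothField X) (hY : IsSmoothField Y) :
    ContMDiff 𝓘(ℝ, E) 𝓘(ℝ) ∞ (g.pair X Y) := by
  intro x
  have h : ContMDiffAt 𝓘(ℝ, E) (𝓘(ℝ, E).prod 𝓘(ℝ)) ∞
      (fun m ↦ TotalSpace.mk' ℝ (E := Bundle.Trivial M ℝ) m (g.form m (X m) (Y m))) x :=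
    ContMDiffAt.clm_bundle_apply₂ (F₁ := E) (F₂ := E) (g.contMDiff x) (hX x) (hY x)
  simp only [contMDiffAt_totalSpace] at h
  exact h.2

/-- The directional derivative, as a derivation of the algebra of smooth functions. -/
def fieldDeriv : smoothFields E M →ₗ[smoothFunctions E M]
    Derivation ℝ (smoothFunctions E M) (smoothFunctions E M) where
  toFun X := Derivation.mk'
    { toFun f := ⟨dirDeriv X.1 f.1, contMDiff_dirDeriv X.2 f.2⟩
      map_add' f h := by
        ext x
        change mvfderiv 𝓘(ℝ, E) (f.1 + h.1) x (X.1 x) = _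
        rw [mvfderiv_add (smoothFunctions_mdifferentiableAt f x)
          (smoothFunctions_mdifferentiableAt h x)]
        rfl
      map_smul' c f := by
        ext x
        change mvfderiv 𝓘(ℝ, E) ((fun _ ↦ c) * f.1) x (X.1 x) = c * mvfderiv 𝓘(ℝ, E) f.1 x (X.1 x)
        rw [mvfderiv_mul mdifferentiableAt_const (smoothFunctions_mdifferentiableAt f x),
          mvfderiv_const]
        simp }
    fun f h ↦ by
      ext x
      change mvfderiv 𝓘(ℝ, E) (f.1 * h.1) x (X.1 x) =
        f.1 x * mvfderiv 𝓘(ℝ, E) h.1 x (X.1 x) + h.1 x * mvfderiv 𝓘(ℝ, E) f.1 x (X.1 x)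
      rw [mvfderiv_mul (smoothFunctions_mdifferentiableAt f x)
        (smoothFunctions_mdifferentiableAt h x)]
      simp
  map_add' X Y := by
    ext f x
    exact map_add (mvfderiv 𝓘(ℝ, E) f.1 x) _ _
  map_smul' h X := by
    ext f x
    exact map_smul (mvfderiv 𝓘(ℝ, E) f.1 x) (h.1 x) (X.1 x)

lemma fieldDeriv_apply (X : smoothFields E M) (f : smoothFunctions E M) (x : M) :
    (fieldDeriv X f).1 x = dirDeriv X.1 f.1 x := rfl

/-- A pseudo-Riemannian metric, as a bilinear form on the module of vector fields. -/
def PseudoMetric.fieldForm (g : PseudoMetric E M) : smoothFields E M →ₗ[smoothFunctions E M]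
    smoothFields E M →ₗ[smoothFunctions E M] smoothFunctions E M :=
  LinearMap.mk₂ _ (fun X Y ↦ ⟨g.pair X.1 Y.1, contMDiff_pair g X.2 Y.2⟩)
    (fun X X' Y ↦ Subtype.ext (PseudoMetric.pair_add_left X.1 X'.1 Y.1))
    (fun f X Y ↦ Subtype.ext (PseudoMetric.pair_smul_left f.1 X.1 Y.1))
    (fun X Y Y' ↦ Subtype.ext (PseudoMetric.pair_add_right X.1 Y.1 Y'.1))
    (fun f X Y ↦ Subtype.ext (PseudoMetric.pair_smul_right f.1 X.1 Y.1))

lemma PseudoMetric.fieldForm_apply (g : PseudoMetric E M) (X Y : smoothFields E M) (x : M) :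
    (g.fieldForm X Y).1 x = g.form x (X.1 x) (Y.1 x) := rfl

variable [FiniteDimensional ℝ E]

/-- The Lie bracket of smooth vector fields. -/
def fieldBracket (X Y : smoothFields E M) : smoothFields E M :=
  ⟨bracket X.1 Y.1, by
    have : CompleteSpace E := FiniteDimensional.complete ℝ E
    have : IsManifold 𝓘(ℝ, E) (minSmoothness ℝ 2) M := by
      rw [minSmoothness_of_isRCLikeNormedField]
      exact IsManifold.of_le (n := ∞) (WithTop.coe_le_coe.2 le_top : ((2 : ℕ∞) : WithTop ℕ∞) ≤ _)
    have : IsManifold 𝓘(ℝ, E) (((⊤ : ℕ∞) : WithTop ℕ∞) + 1) M := ‹IsManifold 𝓘(ℝ, E) ∞ M›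
    refine ContDiff.mlieBracket_vectorField (m := ⊤) (n := ⊤) X.2 Y.2 ?_
    rw [minSmoothness_of_isRCLikeNormedField]
    exact le_rfl⟩

lemma fieldBracket_swap (X Y : smoothFields E M) : fieldBracket X Y = -fieldBracket Y X :=
  Subtype.ext VectorField.mlieBracket_swap

lemma fieldBracket_smul_right (X : smoothFields E M) (f : smoothFunctions E M)
    (Y : smoothFields E M) :
    fieldBracket X (f • Y) = fieldDeriv X f • Y + f • fieldBracket X Y :=
  have : CompleteSpace E := FiniteDimensional.complete ℝ E
  smoothFields_ext fun x ↦ VectorField.mlieBracket_smul_right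
    (smoothFunctions_mdifferentiableAt f x) (smoothFields_mdifferentiableAt Y x)

lemma fieldBracket_add_right (X Y Z : smoothFields E M) :
    fieldBracket X (Y + Z) = fieldBracket X Y + fieldBracket X Z :=
  have : CompleteSpace E := FiniteDimensional.complete ℝ E
  smoothFields_ext fun x ↦ VectorField.mlieBracket_add_right
    (smoothFields_mdifferentiableAt Y x) (smoothFields_mdifferentiableAt Z x)

lemma fieldBracket_leibniz (X Y Z : smoothFields E M) :
    fieldBracket X (fieldBracket Y Z) =
      fieldBracket (fieldBracket X Y) Z + fieldBracket Y (fieldBracket X Z) := by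
  have : CompleteSpace E := FiniteDimensional.complete ℝ E
  have : IsManifold 𝓘(ℝ, E) (minSmoothness ℝ 3) M := by
    rw [minSmoothness_of_isRCLikeNormedField]
    exact IsManifold.of_le (n := ∞) (WithTop.coe_le_coe.2 le_top : ((3 : ℕ∞) : WithTop ℕ∞) ≤ _)
  have h (X : smoothFields E M) (x : M) : CMDiffAt (minSmoothness ℝ 2) (T% X.1) x := by
    rw [minSmoothness_of_isRCLikeNormedField]
    exact (X.2 x).of_le (WithTop.coe_le_coe.2 le_top : ((2 : ℕ∞) : WithTop ℕ∞) ≤ _)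
  exact smoothFields_ext fun x ↦
    VectorField.leibniz_identity_mlieBracket_apply (h X x) (h Y x) (h Z x)

lemma fieldBracket_jacobi (X Y Z : smoothFields E M) :
    fieldBracket X (fieldBracket Y Z) + fieldBracket Y (fieldBracket Z X)
      + fieldBracket Z (fieldBracket X Y) = 0 := by
  have hneg (X Y : smoothFields E M) : fieldBracket X (-Y) = -fieldBracket X Y := by
    have h := fieldBracket_smul_right X (-1) Y
    simpa using h
  rw [fieldBracket_leibniz X Y Z, fieldBracket_swap (fieldBracket X Y) Z, fieldBracket_swap Z X,
    hneg]
  abel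

variable [T2Space M]

/-- The Leibniz identity for `[X, [Y, fZ]]` leaves the difference of the two sides as a scalar
multiplying an arbitrary `Z`. -/
lemma fieldDeriv_bracket (X Y : smoothFields E M) (f : smoothFunctions E M) :
    fieldDeriv (fieldBracket X Y) f =
      fieldDeriv X (fieldDeriv Y f) - fieldDeriv Y (fieldDeriv X f) := by
  have h (Z : smoothFields E M) : (fieldDeriv (fieldBracket X Y) f -
      (fieldDeriv X (fieldDeriv Y f) - fieldDeriv Y (fieldDeriv X f))) • Z = 0 := by
    have h := fieldBracket_leibniz X Y (f • Z)
    simp only [fieldBracket_smul_right, fieldBracket_add_right] at h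
    rw [fieldBracket_leibniz X Y Z] at h
    have h' := sub_eq_zero.2 h
    rw [← neg_eq_zero, ← h']
    module
  ext x
  by_cases hx : ∃ v : TangentSpace 𝓘(ℝ, E) x, v ≠ 0
  · obtain ⟨v, hv⟩ := hx
    have h := congr($(h (fieldExtension v)).1 x)
    rw [smoothFields_smul_apply, fieldExtension_apply] at h
    exact sub_eq_zero.1 ((smul_eq_zero.1 h).resolve_right hv)
  -- If the tangent space is zero, no `Z` detects the scalar, but all derivatives vanish there.
  · push Not at hx
    have h₀ (X : smoothFields E M) (f : smoothFunctions E M) : (fieldDeriv X f).1 x = 0 := by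
      rw [fieldDeriv_apply, dirDeriv, hx (X.1 x), map_zero]
    change _ = (fieldDeriv X (fieldDeriv Y f)).1 x - (fieldDeriv Y (fieldDeriv X f)).1 x
    rw [h₀, h₀, h₀, sub_zero]

lemma eq_of_cutoff_mul_eq {f h : smoothFunctions E M}
    (e : ∀ (x : M) (F : CutoffFrame E x), F.cutoff * F.cutoff * f = F.cutoff * F.cutoff * h) :
    f = h := by
  ext x
  obtain ⟨F⟩ := exists_cutoffFrame E x
  have e := congr($(e x F).1 x)
  change F.cutoff.1 x * F.cutoff.1 x * f.1 x = F.cutoff.1 x * F.cutoff.1 x * h.1 x at e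
  simpa only [F.cutoff_self, one_mul] using e

omit [FiniteDimensional ℝ E] [T2Space M] in
lemma CutoffFrame.cutoff_mul_apply {x : M} (F : CutoffFrame E x)
    (l : smoothFields E M →ₗ[smoothFunctions E M] smoothFunctions E M) (X : smoothFields E M) :
    F.cutoff * F.cutoff * l X = ∑ i, F.coframe i X * l (F.frame i) := by
  rw [← smul_eq_mul, ← map_smul, ← F.sum_coframe_smul, map_sum]
  simp only [map_smul, smul_eq_mul]

namespace PseudoMetric

variable (g : PseudoMetric E M)

omit [FiniteDimensional ℝ E] [T2Space M] in
lemma fieldForm_symm (X Y : smoothFields E M) : g.fieldForm X Y = g.fieldForm Y X :=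
  Subtype.ext (pair_comm X.1 Y.1)

lemma fieldForm_nondegenerate (X : smoothFields E M) (hX : ∀ Y, g.fieldForm X Y = 0) : X = 0 :=
  smoothFields_ext fun x ↦ g.nondegenerate x _ fun w ↦ by
    have h := congr($(hX (fieldExtension w)).1 x)
    rwa [fieldForm_apply, fieldExtension_apply] at h

/-- A null vector of the Gram matrix would give a tangent vector orthogonal to the whole frame at
`x`. -/
lemma det_gram_ne_zero {x : M} (F : CutoffFrame E x) :
    (Matrix.of fun i j ↦ g.fieldForm (F.frame i) (F.frame j)).det.1 x ≠ 0 := by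
  let ev : smoothFunctions E M →+* ℝ :=
    (Pi.evalRingHom _ x).comp (smoothFunctions E M).val.toRingHom
  change ev _ ≠ 0
  rw [RingHom.map_det]
  intro h
  obtain ⟨v, hv, h⟩ := Matrix.exists_vecMul_eq_zero_iff.2 h
  refine hv (funext (Fintype.linearIndependent_iff.1 F.linearIndependent v
    (g.nondegenerate x _ fun w ↦ ?_)))
  have hw := congr($(F.sum_coframe_smul (fieldExtension w)).1 x)
  rw [smoothFields_sum_apply, smoothFields_smul_apply, fieldExtension_apply] at hw
  have h₁ : (F.cutoff * F.cutoff).1 x = 1 := by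
    change F.cutoff.1 x * F.cutoff.1 x = 1
    rw [F.cutoff_self, one_mul]
  rw [h₁, one_smul] at hw
  rw [← hw, map_sum]
  refine Finset.sum_eq_zero fun k _ ↦ ?_
  rw [smoothFields_smul_apply, map_smul, map_sum, sum_apply]
  have h : Matrix.vecMul v _ k = 0 := congr($h k)
  have e : ∑ i, g.form x (v i • (F.frame i).1 x) ((F.frame k).1 x) = 0 := by
    rw [← h]
    refine Finset.sum_congr rfl fun i _ ↦ ?_
    rw [map_smul]
    rfl
  rw [e, smul_zero]

/-- The dual vector exists pointwise by `flat`; its smoothness is Cramer's rule in a cutoff frame.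
-/
lemma exists_fieldForm_eq (l : smoothFields E M →ₗ[smoothFunctions E M] smoothFunctions E M) :
    ∃ X, ∀ Y, g.fieldForm X Y = l Y := by
  have (x : M) : T2Space (TangentSpace 𝓘(ℝ, E) x) := inferInstanceAs (T2Space E)
  let s (x : M) : TangentSpace 𝓘(ℝ, E) x :=
    (g.flat x).symm (LinearMap.toContinuousLinearMap (evalFunctional x l))
  have hs (x : M) (Y : smoothFields E M) : g.form x (s x) (Y.1 x) = (l Y).1 x := by
    rw [← g.flat_apply, ContinuousLinearEquiv.apply_symm_apply]
    exact evalFunctional_apply x l Y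
  refine ⟨⟨s, fun x ↦ ?_⟩, fun Y ↦ Subtype.ext (funext fun x ↦ hs x Y)⟩
  obtain ⟨F⟩ := exists_cutoffFrame E x
  let G : Matrix (Fin (finrank ℝ E)) (Fin (finrank ℝ E)) (smoothFunctions E M) :=
    Matrix.of fun i j ↦ g.fieldForm (F.frame i) (F.frame j)
  let lv (i : Fin (finrank ℝ E)) : smoothFunctions E M := l (F.frame i)
  -- The adjugate avoids division: `Z` is smooth, and near `x` it equals the Gram determinant times
  -- the dual vector.
  let Z : smoothFields E M := ∑ i, Matrix.vecMul lv G.adjugate i • F.frame i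
  have hZ₁ (k : Fin (finrank ℝ E)) : g.fieldForm Z (F.frame k) = G.det * l (F.frame k) := by
    have h : Matrix.vecMul (Matrix.vecMul lv G.adjugate) G k = G.det * l (F.frame k) := by
      rw [Matrix.vecMul_vecMul, Matrix.adjugate_mul, Matrix.vecMul_smul, Matrix.vecMul_one]
      rfl
    rw [← h, map_sum, LinearMap.sum_apply]
    refine Finset.sum_congr rfl fun i _ ↦ ?_
    rw [map_smul]
    rfl
  have hZ₂ (Y : smoothFields E M) :
      F.cutoff * F.cutoff * g.fieldForm Z Y = F.cutoff * F.cutoff * (G.det * l Y) := by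
    rw [mul_left_comm, F.cutoff_mul_apply, F.cutoff_mul_apply, Finset.mul_sum]
    refine Finset.sum_congr rfl fun i _ ↦ ?_
    rw [hZ₁, mul_left_comm]
  have hd : ∀ᶠ y in 𝓝 x, G.det.1 y ≠ 0 :=
    (G.det.2 x).continuousAt.eventually_ne (g.det_gram_ne_zero F)
  have hZ₃ : ∀ᶠ y in 𝓝 x, s y = (G.det.1 y)⁻¹ • Z.1 y := by
    filter_upwards [hd, F.cutoff_eventually] with y hy hc
    refine sub_eq_zero.1 (g.nondegenerate y _ fun w ↦ ?_)
    have h := congr($(hZ₂ (fieldExtension w)).1 y)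
    change F.cutoff.1 y * F.cutoff.1 y * (g.fieldForm Z (fieldExtension w)).1 y =
      F.cutoff.1 y * F.cutoff.1 y * (G.det.1 y * (l (fieldExtension w)).1 y) at h
    rw [hc, one_mul, one_mul, one_mul, fieldForm_apply, fieldExtension_apply] at h
    have h' := hs y (fieldExtension w)
    rw [fieldExtension_apply] at h'
    rw [map_sub, sub_apply, map_smul, smul_apply, h', h, smul_eq_mul,
      inv_mul_cancel_left₀ hy, sub_self]
  have h : ContMDiffAt 𝓘(ℝ, E) (𝓘(ℝ, E).prod 𝓘(ℝ, E)) ∞ (fun y ↦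
      (TotalSpace.mk y ((G.det.1 y)⁻¹ • Z.1 y) : TangentBundle 𝓘(ℝ, E) M)) x :=
    ContMDiffAt.smul_section ((G.det.2 x).inv₀ (g.det_gram_ne_zero F)) (Z.2 x)
  refine h.congr_of_eventuallyEq ?_
  filter_upwards [hZ₃] with y hy
  rw [hy]

/-- The right-hand side of the Koszul formula, as a functional on the module of vector fields. -/
def fieldKoszul (X Y : smoothFields E M) :
    smoothFields E M →ₗ[smoothFunctions E M] smoothFunctions E M where
  toFun Z := fieldDeriv X (g.fieldForm Y Z) + fieldDeriv Y (g.fieldForm X Z)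
    - fieldDeriv Z (g.fieldForm X Y) + g.fieldForm (fieldBracket X Y) Z
    - g.fieldForm (fieldBracket X Z) Y - g.fieldForm (fieldBracket Y Z) X
  map_add' Z Z' := Subtype.ext (funext fun x ↦ koszul_add_right (smoothFields_mdifferentiableAt X x)
    (smoothFields_mdifferentiableAt Y x) (smoothFields_mdifferentiableAt Z x)
    (smoothFields_mdifferentiableAt Z' x))
  map_smul' f Z := Subtype.ext (funext fun x ↦ koszul_smul_right
    (smoothFunctions_mdifferentiableAt f x) (smoothFields_mdifferentiableAt X x)
    (smoothFields_mdifferentiableAt Y x) (smoothFields_mdifferentiableAt Z x))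

/-- `∇_X Y` is the metric dual of half the Koszul functional. -/
lemma isSmoothField_leviCivita (X Y : smoothFields E M) :
    IsSmoothField fun x ↦ g.leviCivita Y.1 x (X.1 x) := by
  obtain ⟨N, hN⟩ := g.exists_fieldForm_eq
    (algebraMap ℝ (smoothFunctions E M) (1 / 2) • g.fieldKoszul X Y)
  have h : (fun x ↦ g.leviCivita Y.1 x (X.1 x)) = N.1 := by
    ext1 x
    refine sub_eq_zero.1 (g.nondegenerate x _ fun w ↦ ?_)
    have h₁ := congr($(hN (fieldExtension w)).1 x)
    have h₂ := g.two_mul_form_leviCivitaFun (smoothFields_mdifferentiableAt X x)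
      (smoothFields_mdifferentiableAt Y x) (smoothFields_mdifferentiableAt (fieldExtension w) x)
    change g.form x (N.1 x) ((fieldExtension w).1 x) =
      1 / 2 * g.koszul X.1 Y.1 (fieldExtension w).1 x at h₁
    change 2 * g.form x (g.leviCivita Y.1 x (X.1 x)) _ = _ at h₂
    rw [fieldExtension_apply] at h₁ h₂
    rw [map_sub, sub_apply, h₁, ← h₂]
    ring
  rw [h]
  exact N.2

/-- The Levi-Civita connection on the module of vector fields. -/
def fieldNabla :
    smoothFields E M →ₗ[smoothFunctions E M] (smoothFields E M →+ smoothFields E M) where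
  toFun X :=
    { toFun Y := ⟨fun x ↦ g.leviCivita Y.1 x (X.1 x), g.isSmoothField_leviCivita X Y⟩
      map_zero' := smoothFields_ext fun x ↦ by
        change g.leviCivita 0 x (X.1 x) = 0
        rw [g.leviCivita.zero]
        rfl
      map_add' Y Z := smoothFields_ext fun x ↦ by
        change g.leviCivita (Y.1 + Z.1) x (X.1 x) = _
        rw [g.leviCivita.isCovariantDerivativeOnUniv.add (smoothFields_mdifferentiableAt Y x)
          (smoothFields_mdifferentiableAt Z x)]
        rfl }
  map_add' X X' := AddMonoidHom.ext fun Y ↦ smoothFields_ext fun x ↦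
    map_add (g.leviCivita Y.1 x) _ _
  map_smul' f X := AddMonoidHom.ext fun Y ↦ smoothFields_ext fun x ↦
    map_smul (g.leviCivita Y.1 x) (f.1 x) (X.1 x)

lemma fieldNabla_apply (X Y : smoothFields E M) (x : M) :
    (g.fieldNabla X Y).1 x = g.leviCivita Y.1 x (X.1 x) := rfl

lemma fieldNabla_smul (X : smoothFields E M) (f : smoothFunctions E M) (Y : smoothFields E M) :
    g.fieldNabla X (f • Y) = fieldDeriv X f • Y + f • g.fieldNabla X Y :=
  smoothFields_ext fun x ↦ by
    change g.leviCivita (f.1 • Y.1) x (X.1 x) = _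
    rw [g.leviCivita.isCovariantDerivativeOnUniv.leibniz (smoothFields_mdifferentiableAt Y x)
      (smoothFunctions_mdifferentiableAt f x)]
    exact add_comm _ _

lemma fieldNabla_sub (X Y : smoothFields E M) :
    g.fieldNabla X Y - g.fieldNabla Y X = fieldBracket X Y :=
  smoothFields_ext fun x ↦ g.leviCivita_torsion_free (smoothFields_mdifferentiableAt X x)
    (smoothFields_mdifferentiableAt Y x)

lemma fieldTrace_adjoint (S T : smoothFields E M →ₗ[smoothFunctions E M] smoothFields E M)
    (h : ∀ X Y, g.fieldForm (S X) Y = g.fieldForm X (T Y)) : fieldTrace S = fieldTrace T := by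
  refine eq_of_cutoff_mul_eq fun x F ↦ ?_
  choose t ht using fun i ↦ g.exists_fieldForm_eq (F.coframe i)
  -- The adjoint of the rank-one decomposition of `χ²S`, with `t i` dual to the coframe; the traces
  -- agree term by term.
  have hT : ∑ i, (g.fieldForm (S (F.frame i))).smulRight (t i) = (F.cutoff * F.cutoff) • T := by
    refine LinearMap.ext fun Y ↦ sub_eq_zero.1 (g.fieldForm_nondegenerate _ fun Z ↦ ?_)
    rw [map_sub, LinearMap.sub_apply, LinearMap.smul_apply, map_smul, LinearMap.smul_apply,
      ← map_smul, ← F.sum_coframe_smul, sub_eq_zero, LinearMap.sum_apply, map_sum, map_sum,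
      LinearMap.sum_apply]
    refine Finset.sum_congr rfl fun i _ ↦ ?_
    rw [LinearMap.smulRight_apply, map_smul, LinearMap.smul_apply, map_smul, ht, h,
      g.fieldForm_symm (T Y), smul_eq_mul, smul_eq_mul, mul_comm]
  have hc (S : smoothFields E M →ₗ[smoothFunctions E M] smoothFields E M) :
      F.cutoff * F.cutoff * fieldTrace S = fieldTrace ((F.cutoff * F.cutoff) • S) := by
    rw [map_smul, smul_eq_mul]
  rw [hc, hc, ← hT, ← F.sum_smulRight, map_sum, map_sum]
  refine Finset.sum_congr rfl fun i _ ↦ ?_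
  rw [fieldTrace_smulRight, fieldTrace_smulRight, g.fieldForm_symm, ht]

lemma fieldDeriv_trace (W : smoothFields E M)
    (S T : smoothFields E M →ₗ[smoothFunctions E M] smoothFields E M)
    (h : ∀ X, T X = g.fieldNabla W (S X) - S (g.fieldNabla W X)) :
    fieldDeriv W (fieldTrace S) = fieldTrace T := by
  refine eq_of_cutoff_mul_eq fun x F ↦ ?_
  -- `ψ i` is `∇_W` of the coframe element. Differentiating the decomposition of `χ²S` before and
  -- after taking the trace, the terms with `W(χ²)` cancel.
  let ψ (i : Fin (finrank ℝ E)) : smoothFields E M →ₗ[smoothFunctions E M] smoothFunctions E M :=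
    { toFun X := fieldDeriv W (F.coframe i X) - F.coframe i (g.fieldNabla W X)
      map_add' X Y := by
        simp only [map_add]
        ring
      map_smul' f X := by
        simp only [map_smul, map_add, fieldNabla_smul, smul_eq_mul, Derivation.leibniz,
          RingHom.id_apply]
        ring }
  have hψ (i) (X : smoothFields E M) :
      ψ i X = fieldDeriv W (F.coframe i X) - F.coframe i (g.fieldNabla W X) := rfl
  have e₁ : ∑ i, ((ψ i).smulRight (S (F.frame i)) +
      (F.coframe i).smulRight (g.fieldNabla W (S (F.frame i)))) =
      fieldDeriv W (F.cutoff * F.cutoff) • S + (F.cutoff * F.cutoff) • T := by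
    ext1 X
    have e (X : smoothFields E M) :
        ∑ i, F.coframe i X • S (F.frame i) = (F.cutoff * F.cutoff) • S X := by
      rw [← LinearMap.smul_apply, ← F.sum_smulRight, LinearMap.sum_apply]
      rfl
    have e' := congr(g.fieldNabla W $(e X))
    rw [map_sum, fieldNabla_smul] at e'
    rw [LinearMap.add_apply, LinearMap.smul_apply, LinearMap.smul_apply, h, smul_sub,
      ← add_sub_assoc, ← e', ← e, LinearMap.sum_apply, ← Finset.sum_sub_distrib]
    refine Finset.sum_congr rfl fun i _ ↦ ?_
    rw [LinearMap.add_apply, LinearMap.smulRight_apply, LinearMap.smulRight_apply, hψ,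
      fieldNabla_smul]
    module
  have e₂ := congr(fieldTrace $e₁)
  rw [map_sum, map_add, map_smul, map_smul] at e₂
  have e₃ := congr(fieldDeriv W (fieldTrace $(F.sum_smulRight S)))
  rw [map_sum, map_sum, map_smul, smul_eq_mul, Derivation.leibniz] at e₃
  have e₄ : ∑ i, fieldTrace ((ψ i).smulRight (S (F.frame i)) +
      (F.coframe i).smulRight (g.fieldNabla W (S (F.frame i)))) =
      ∑ i, fieldDeriv W (fieldTrace ((F.coframe i).smulRight (S (F.frame i)))) :=
    Finset.sum_congr rfl fun i _ ↦ by
      rw [map_add, fieldTrace_smulRight, fieldTrace_smulRight, fieldTrace_smulRight, hψ]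
      ring
  rw [e₄, e₃] at e₂
  simp only [smul_eq_mul] at e₂
  linear_combination e₂

/-- The algebraic structure carried by the vector fields of a pseudo-Riemannian manifold. -/
def fieldAlgebra : LeviCivitaAlgebra (smoothFunctions E M) (smoothFields E M) where
  deriv := fieldDeriv
  nabla := g.fieldNabla
  metric := g.fieldForm
  trace := fieldTrace
  metric_symm := g.fieldForm_symm
  metric_nondegenerate := g.fieldForm_nondegenerate
  exists_metric_eq := g.exists_fieldForm_eq
  nabla_smul := g.fieldNabla_smul
  deriv_metric X Y Z := Subtype.ext (funext fun x ↦ g.leviCivita_metric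
    (smoothFields_mdifferentiableAt X x) (smoothFields_mdifferentiableAt Y x)
    (smoothFields_mdifferentiableAt Z x))
  deriv_nabla_sub X Y f := by rw [fieldNabla_sub, fieldDeriv_bracket]
  jacobi X Y Z := by simp only [fieldNabla_sub, fieldBracket_jacobi]
  trace_smulRight := fieldTrace_smulRight
  trace_comp_comm := fieldTrace_comp_comm
  trace_adjoint := g.fieldTrace_adjoint
  deriv_trace := g.fieldDeriv_trace

end PseudoMetric

end FieldCalculus

end ParaSasaki

end

/-! ### Pointwise curvature and Ricci tensor compared with the algebraic ones -/

noncomputable section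

namespace ParaSasaki

section Curvature

variable {E : Type*} [NormedAddCommGroup E] [NormedSpace ℝ E]
  {M : Type*} [TopologicalSpace M] [ChartedSpace E M] [IsManifold 𝓘(ℝ, E) ∞ M]
  [FiniteDimensional ℝ E]

namespace PseudoMetric

variable (g : PseudoMetric E M)

lemma leviCivita_congr {x : M} {Y : Π x : M, TangentSpace 𝓘(ℝ, E) x} {Y' : smoothFields E M}
    (h : ∀ᶠ y in 𝓝 x, Y y = Y'.1 y) : g.leviCivita Y x = g.leviCivita Y'.1 x := by
  have hY : MDiffAt (T% Y) x :=
    (smoothFields_mdifferentiableAt Y' x).congr_of_eventuallyEq (by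
      filter_upwards [h] with y hy
      rw [hy])
  exact g.leviCivita.isCovariantDerivativeOnUniv.congr_of_eventuallyEq hY
    (smoothFields_mdifferentiableAt Y' x) Filter.univ_mem h

variable [T2Space M]

/-- Curvature depends only on germs: the inner derivatives agree near `x`, so the outer ones agree
at `x`. -/
lemma curvature_congr {x : M} {X Y Z : Π x : M, TangentSpace 𝓘(ℝ, E) x}
    {X' Y' Z' : smoothFields E M} (hX : ∀ᶠ y in 𝓝 x, X y = X'.1 y)
    (hY : ∀ᶠ y in 𝓝 x, Y y = Y'.1 y) (hZ : ∀ᶠ y in 𝓝 x, Z y = Z'.1 y) :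
    g.curvature X Y Z x = (g.fieldAlgebra.curvature X' Y' Z').1 x := by
  have h {X Z : Π x : M, TangentSpace 𝓘(ℝ, E) x} {X' Z' : smoothFields E M}
      (hX : ∀ᶠ y in 𝓝 x, X y = X'.1 y) (hZ : ∀ᶠ y in 𝓝 x, Z y = Z'.1 y) :
      ∀ᶠ y in 𝓝 x, g.leviCivita Z y (X y) = (g.fieldNabla X' Z').1 y := by
    filter_upwards [hX, hZ.eventually_nhds] with y hy hy'
    rw [hy, g.leviCivita_congr hy', fieldNabla_apply]
  have h' : (g.fieldAlgebra.curvature X' Y' Z') = g.fieldNabla X' (g.fieldNabla Y' Z') -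
      g.fieldNabla Y' (g.fieldNabla X' Z') - g.fieldNabla (fieldBracket X' Y') Z' := by
    rw [← g.fieldNabla_sub]
    rfl
  have hb : bracket X Y x = bracket X'.1 Y'.1 x :=
    Filter.EventuallyEq.mlieBracket_vectorField_eq hX hY
  rw [h', curvature, g.leviCivita_congr (h hY hZ), g.leviCivita_congr (h hX hZ),
    g.leviCivita_congr hZ, hX.self_of_nhds, hY.self_of_nhds, hb]
  rfl

/-- `curvature_congr` replaces the chart extensions by smooth fields, and tensoriality in each slot
then allows any fields with the same values at `x`. -/
lemma curvatureAt_eq {x : M} (X Y Z : smoothFields E M) :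
    g.curvatureAt x (X.1 x) (Y.1 x) (Z.1 x) = (g.fieldAlgebra.curvature X Y Z).1 x := by
  obtain ⟨X', hX⟩ := exists_smoothField_eventuallyEq_extend (X.1 x)
  obtain ⟨Y', hY⟩ := exists_smoothField_eventuallyEq_extend (Y.1 x)
  obtain ⟨Z', hZ⟩ := exists_smoothField_eventuallyEq_extend (Z.1 x)
  rw [curvatureAt, g.curvature_congr (hX.mono fun y h ↦ h.symm) (hY.mono fun y h ↦ h.symm)
    (hZ.mono fun y h ↦ h.symm)]
  have hX := hX.self_of_nhds
  have hY := hY.self_of_nhds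
  have hZ := hZ.self_of_nhds
  rw [FiberBundle.extend_apply_self] at hX hY hZ
  have h {X X' : smoothFields E M} (hX : X'.1 x = X.1 x) (Y Z : smoothFields E M) :
      (g.fieldAlgebra.curvature X' Y Z).1 x = (g.fieldAlgebra.curvature X Y Z).1 x :=
    end_apply_eq (g.fieldAlgebra.ricciEnd Y Z) hX
  have h' : (g.fieldAlgebra.curvature X Y' Z).1 x = (g.fieldAlgebra.curvature X Y Z).1 x := by
    rw [LeviCivitaAlgebra.curvature_swap, LeviCivitaAlgebra.curvature_swap _ X Y]
    exact congr(-$(h hY X Z))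
  rw [h hX, end_apply_eq _ hZ, h']

lemma ricci_eq {x : M} (Y Z : smoothFields E M) :
    g.ricci x (Y.1 x) (Z.1 x) = (g.fieldAlgebra.ricci Y Z).1 x := by
  have h : (g.fieldAlgebra.ricci Y Z).1 x =
      LinearMap.trace ℝ (TangentSpace 𝓘(ℝ, E) x) (evalEnd x (g.fieldAlgebra.ricciEnd Y Z)) := rfl
  let b : Basis (Fin (finrank ℝ E)) ℝ (TangentSpace 𝓘(ℝ, E) x) := finBasis ℝ E
  rw [h, LinearMap.trace_eq_matrix_trace ℝ b, Matrix.trace]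
  refine Finset.sum_congr rfl fun i _ ↦ ?_
  rw [Matrix.diag_apply, LinearMap.toMatrix_apply]
  have e : evalEnd x (g.fieldAlgebra.ricciEnd Y Z) (b i) =
      g.curvatureAt x (b i) (Y.1 x) (Z.1 x) := by
    have h := g.curvatureAt_eq (x := x) (fieldExtension (b i)) Y Z
    rw [fieldExtension_apply] at h
    exact h.symm
  rw [e]
  rfl

end PseudoMetric

end Curvature

/-! ### The para-Sasakian structure and the soliton equation on smooth fields -/

section Structure

variable {E : Type*} [NormedAddCommGroup E] [NormedSpace ℝ E]
  {M : Type*} [TopologicalSpace M] [ChartedSpace E M] [IsManifold 𝓘(ℝ, E) ∞ M] {n : ℕ}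

namespace AlmostParacontactMetric

variable (P : AlmostParacontactMetric E M n)

lemma contMDiff_etaField {X : Π x : M, TangentSpace 𝓘(ℝ, E) x} (hX : IsSmoothField X) :
    ContMDiff 𝓘(ℝ, E) 𝓘(ℝ) ∞ (P.etaField X) := by
  intro x
  have h : ContMDiffAt 𝓘(ℝ, E) (𝓘(ℝ, E).prod 𝓘(ℝ)) ∞
      (fun m ↦ TotalSpace.mk' ℝ (E := Bundle.Trivial M ℝ) m (P.eta m (X m))) x :=
    ContMDiffAt.clm_bundle_apply (F₁ := E) (P.smooth_eta x) (hX x)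
  simp only [contMDiffAt_totalSpace] at h
  exact h.2

lemma isSmoothField_phiField {X : Π x : M, TangentSpace 𝓘(ℝ, E) x} (hX : IsSmoothField X) :
    IsSmoothField (P.phiField X) :=
  ContMDiff.clm_bundle_apply (F₁ := E) P.smooth_phi hX

/-- The endomorphism `φ` of the module of vector fields. -/
def fieldPhi : smoothFields E M →ₗ[smoothFunctions E M] smoothFields E M where
  toFun X := ⟨P.phiField X.1, P.isSmoothField_phiField X.2⟩
  map_add' X Y := smoothFields_ext fun x ↦ map_add (P.phi x) (X.1 x) (Y.1 x)
  map_smul' f X := smoothFields_ext fun x ↦ map_smul (P.phi x) (f.1 x) (X.1 x)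

/-- The functional `η` on the module of vector fields. -/
def fieldEta : smoothFields E M →ₗ[smoothFunctions E M] smoothFunctions E M where
  toFun X := ⟨P.etaField X.1, P.contMDiff_etaField X.2⟩
  map_add' X Y := Subtype.ext (funext fun x ↦ map_add (P.eta x) (X.1 x) (Y.1 x))
  map_smul' f X := Subtype.ext (funext fun x ↦ map_smul (P.eta x) (f.1 x) (X.1 x))

variable [FiniteDimensional ℝ E] [T2Space M]

variable {P} in
/-- The algebraic structure carried by the vector fields of a para-Sasakian manifold. -/
def IsParaSasakian.fieldAlgebra (hP : P.IsParaSasakian) (hdim : finrank ℝ E = 2 * n + 1) :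
    ParaSasakiAlgebra (smoothFunctions E M) (smoothFields E M) n where
  toLeviCivitaAlgebra := P.metric.fieldAlgebra
  phi := P.fieldPhi
  xi := ⟨P.xi, P.smooth_xi⟩
  eta := P.fieldEta
  phi_phi X := smoothFields_ext fun x ↦ P.phi_phi x (X.1 x)
  eta_xi := Subtype.ext (funext P.eta_xi)
  compatible X Y := Subtype.ext (funext fun x ↦ P.compatible x (X.1 x) (Y.1 x))
  paracontact X Y := by
    change fieldDeriv X (P.fieldEta Y) - fieldDeriv Y (P.fieldEta X)
      - P.fieldEta (P.metric.fieldNabla X Y - P.metric.fieldNabla Y X) =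
      2 * P.metric.fieldForm X (P.fieldPhi Y)
    rw [P.metric.fieldNabla_sub]
    refine Subtype.ext (funext fun x ↦ ?_)
    have h := hP.paracontact X.1 Y.1 X.2 Y.2 x
    rw [dEta] at h
    change dirDeriv X.1 (P.etaField Y.1) x - dirDeriv Y.1 (P.etaField X.1) x
      - P.eta x (bracket X.1 Y.1 x) = 2 * P.metric.form x (X.1 x) (P.phi x (Y.1 x))
    linarith
  normal X Y := by
    change P.fieldPhi (P.fieldPhi (P.metric.fieldNabla X Y - P.metric.fieldNabla Y X)) +
      (P.metric.fieldNabla (P.fieldPhi X) (P.fieldPhi Y)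
        - P.metric.fieldNabla (P.fieldPhi Y) (P.fieldPhi X))
      - P.fieldPhi (P.metric.fieldNabla X (P.fieldPhi Y) - P.metric.fieldNabla (P.fieldPhi Y) X)
      - P.fieldPhi (P.metric.fieldNabla (P.fieldPhi X) Y - P.metric.fieldNabla Y (P.fieldPhi X))
      - (2 * P.metric.fieldForm X (P.fieldPhi Y)) •
        (⟨P.xi, P.smooth_xi⟩ : smoothFields E M) = 0
    simp only [P.metric.fieldNabla_sub]
    refine smoothFields_ext fun x ↦ ?_
    have h := hP.normal X.1 Y.1 X.2 Y.2 x
    rw [normalityTensor, hP.paracontact X.1 Y.1 X.2 Y.2 x] at h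
    exact h
  trace_id := by
    change fieldTrace LinearMap.id = _
    rw [fieldTrace_id, hdim]
    push_cast
    rfl

end AlmostParacontactMetric

/-- A smooth function on a connected manifold is constant if its derivatives vanish. -/
lemma exists_eq_const_of_fieldDeriv_eq_zero [FiniteDimensional ℝ E] [T2Space M] [ConnectedSpace M]
    {f : smoothFunctions E M} (hf : ∀ X, fieldDeriv X f = 0) : ∃ c, ∀ x, f.1 x = c := by
  have hd (x : M) : mvfderiv 𝓘(ℝ, E) f.1 x = 0 := by
    ext v
    have h := congr($(hf (fieldExtension v)).1 x)
    rwa [fieldDeriv_apply, dirDeriv, fieldExtension_apply] at h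
  have hl : IsLocallyConstant f.1 := by
    refine (IsLocallyConstant.iff_eventually_eq _).2 fun x ↦ ?_
    let e := extChartAt 𝓘(ℝ, E) x
    have ht : IsOpen e.target := isOpen_extChartAt_target x
    obtain ⟨r, hr, hb⟩ := Metric.isOpen_iff.1 ht (e x) (mem_extChartAt_target x)
    have hs (y : E) (hy : y ∈ e.target) : MDiffAt e.symm y :=
      ((contMDiffOn_extChartAt_symm (n := ∞) x).contMDiffAt (ht.mem_nhds hy)).mdifferentiableAt
        (by simp)
    have hD (y : E) (hy : y ∈ e.target) : MDiffAt (f.1 ∘ e.symm) y :=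
      (smoothFunctions_mdifferentiableAt f _).comp y (hs y hy)
    have hz (y : E) (hy : y ∈ e.target) : fderiv ℝ (f.1 ∘ e.symm) y = 0 := by
      rw [← mfderiv_eq_fderiv]
      have h := mvfderiv_comp y (smoothFunctions_mdifferentiableAt f _) (hs y hy)
      rw [hd, ContinuousLinearMap.zero_comp] at h
      exact h
    filter_upwards [extChartAt_source_mem_nhds (I := 𝓘(ℝ, E)) x,
      (continuousAt_extChartAt (I := 𝓘(ℝ, E)) x).preimage_mem_nhds (Metric.ball_mem_nhds _ hr)]
      with y hy hy'
    have h := Metric.isOpen_ball.is_const_of_fderiv_eq_zero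
      (convex_ball (e x) r).isPreconnected
      (fun y hy ↦ (hD y (hb hy)).differentiableAt.differentiableWithinAt)
      (fun y hy ↦ hz y (hb hy)) hy' (Metric.mem_ball_self hr)
    rwa [Function.comp_apply, Function.comp_apply, e.left_inv hy,
      e.left_inv (mem_extChartAt_source x)] at h
  obtain ⟨c, hc⟩ := hl.exists_eq_const
  exact ⟨c, fun x ↦ congr($hc x)⟩

namespace AlmostParacontactMetric

variable {P : AlmostParacontactMetric E M n} [FiniteDimensional ℝ E] [T2Space M]
  {V : smoothFields E M}

lemma IsContactTransformation.isContact {a : smoothFunctions E M}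
    (h : P.IsContactTransformation V.1 a.1) (hP : P.IsParaSasakian)
    (hdim : finrank ℝ E = 2 * n + 1) : (hP.fieldAlgebra hdim).IsContact V a := by
  intro X
  change fieldDeriv V (P.fieldEta X)
    - P.fieldEta (P.metric.fieldNabla V X - P.metric.fieldNabla X V) = a * P.fieldEta X
  rw [P.metric.fieldNabla_sub]
  exact Subtype.ext (funext fun x ↦ h X.1 X.2 x)

lemma IsAlmostConformalEtaRicciSoliton.isSoliton {p : ℝ} {lam mu : smoothFunctions E M}
    (h : P.IsAlmostConformalEtaRicciSoliton p V.1 lam.1 mu.1) (hP : P.IsParaSasakian)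
    (hdim : finrank ℝ E = 2 * n + 1) : (hP.fieldAlgebra hdim).IsSoliton V
      -- Half of `p + 2/(2n+1)` is absorbed into `λ`, matching the term `2λ g` of `IsSoliton`.
      (lam - algebraMap ℝ _ ((p + 2 / (2 * (n : ℝ) + 1)) / 2)) mu := by
  intro X Y
  change fieldDeriv V (P.metric.fieldForm X Y)
    - P.metric.fieldForm (P.metric.fieldNabla V X - P.metric.fieldNabla X V) Y
    - P.metric.fieldForm X (P.metric.fieldNabla V Y - P.metric.fieldNabla Y V)
    + 2 * P.metric.fieldAlgebra.ricci X Y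
    + 2 * (lam - algebraMap ℝ _ ((p + 2 / (2 * (n : ℝ) + 1)) / 2)) * P.metric.fieldForm X Y
    + 2 * mu * (P.fieldEta X * P.fieldEta Y) = 0
  rw [P.metric.fieldNabla_sub, P.metric.fieldNabla_sub]
  refine Subtype.ext (funext fun x ↦ ?_)
  have h := h.equation X.1 Y.1 X.2 Y.2 x
  rw [P.metric.ricci_eq, lieMetric] at h
  change dirDeriv V.1 (P.metric.pair X.1 Y.1) x - P.metric.form x (bracket V.1 X.1 x) (Y.1 x)
    - P.metric.form x (X.1 x) (bracket V.1 Y.1 x) + 2 * (P.metric.fieldAlgebra.ricci X Y).1 x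
    + 2 * (lam.1 x - (p + 2 / (2 * (n : ℝ) + 1)) / 2) * P.metric.form x (X.1 x) (Y.1 x)
    + 2 * mu.1 x * (P.eta x (X.1 x) * P.eta x (Y.1 x)) = 0
  rw [← h]
  ring

end AlmostParacontactMetric

end Structure

end ParaSasaki

end

/-! ### The theorem on the manifold -/

theorem theorem4p2
    {E : Type*} [NormedAddCommGroup E] [NormedSpace ℝ E] [FiniteDimensional ℝ E]
    {M : Type*} [TopologicalSpace M] [ChartedSpace E M] [IsManifold 𝓘(ℝ, E) ∞ M]
    [T2Space M] [SecondCountableTopology M] [ConnectedSpace M]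
    (n : ℕ) (hn : 1 < n) (hdim : finrank ℝ E = 2 * n + 1)
    (P : ParaSasaki.AlmostParacontactMetric E M n) (hP : P.IsParaSasakian)
    (p : ℝ) (V : Π x : M, TangentSpace 𝓘(ℝ, E) x) (lam mu : M → ℝ)
    (hsol : P.IsAlmostConformalEtaRicciSoliton p V lam mu)
    (a : M → ℝ) (ha : ContMDiff 𝓘(ℝ, E) 𝓘(ℝ) ∞ a)
    (hV : P.IsContactTransformation V a) :
    (∃ a₀ lam₀ mu₀ : ℝ, (∀ x, a x = a₀) ∧ (∀ x, lam x = lam₀) ∧ (∀ x, mu x = mu₀) ∧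
      P.IsConformalEtaRicciSoliton p V lam₀ mu₀) ∧
    P.IsEtaEinstein ∧
    (P.IsKilling V ∨ P.LeavesPhiInvariant V) := by
  let V' : ParaSasaki.smoothFields E M := ⟨V, hsol.smooth_field⟩
  let lam' : ParaSasaki.smoothFunctions E M := ⟨lam, hsol.smooth_lam⟩
  let mu' : ParaSasaki.smoothFunctions E M := ⟨mu, hsol.smooth_mu⟩
  let a' : ParaSasaki.smoothFunctions E M := ⟨a, ha⟩
  obtain ⟨h₁, h₂, h₃, h₄, h₅⟩ := ParaSasaki.ParaSasakiAlgebra.IsSoliton.rigidity hn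
    (ParaSasaki.AlmostParacontactMetric.IsAlmostConformalEtaRicciSoliton.isSoliton
      (V := V') (lam := lam') (mu := mu') hsol hP hdim)
    (ParaSasaki.AlmostParacontactMetric.IsContactTransformation.isContact
      (V := V') (a := a') hV hP hdim)
  obtain ⟨a₀, ha₀⟩ := ParaSasaki.exists_eq_const_of_fieldDeriv_eq_zero (f := a') h₁
  obtain ⟨mu₀, hmu₀⟩ := ParaSasaki.exists_eq_const_of_fieldDeriv_eq_zero (f := mu') h₃
  obtain ⟨lam₀, hlam₀⟩ := ParaSasaki.exists_eq_const_of_fieldDeriv_eq_zero (f := lam') fun X ↦ by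
    have h := h₂ X
    rwa [map_sub, Derivation.map_algebraMap, sub_zero] at h
  refine ⟨⟨a₀, lam₀, mu₀, ha₀, hlam₀, hmu₀, ?_⟩,
    -- Half the coefficients from `rigidity`, with the shifted `λ`.
    ⟨-(2 * (lam₀ - (p + 2 / (2 * (n : ℝ) + 1)) / 2) + a₀) / 2,
      (2 * (lam₀ - (p + 2 / (2 * (n : ℝ) + 1)) / 2) + a₀ - 4 * n) / 2, fun x v w ↦ ?_⟩,
    -- The second alternative always holds.
    Or.inr fun X hX x ↦ ?_⟩
  · obtain rfl : lam = fun _ ↦ lam₀ := funext hlam₀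
    obtain rfl : mu = fun _ ↦ mu₀ := funext hmu₀
    exact hsol
  · have h := congr($(h₅ (ParaSasaki.fieldExtension v) (ParaSasaki.fieldExtension w)).1 x)
    have hr := P.metric.ricci_eq (x := x) (ParaSasaki.fieldExtension v)
      (ParaSasaki.fieldExtension w)
    rw [ParaSasaki.fieldExtension_apply, ParaSasaki.fieldExtension_apply] at hr
    change 2 * (P.metric.fieldAlgebra.ricci _ _).1 x =
      -(2 * (lam x - (p + 2 / (2 * (n : ℝ) + 1)) / 2) + a x) *
        P.metric.form x ((ParaSasaki.fieldExtension v).1 x) ((ParaSasaki.fieldExtension w).1 x) +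
      (2 * (lam x - (p + 2 / (2 * (n : ℝ) + 1)) / 2) + a x - 4 * n) *
        (P.eta x ((ParaSasaki.fieldExtension v).1 x) *
          P.eta x ((ParaSasaki.fieldExtension w).1 x)) at h
    rw [ParaSasaki.fieldExtension_apply, ParaSasaki.fieldExtension_apply, ← hr,
      show a x = a₀ from ha₀ x, show lam x = lam₀ from hlam₀ x] at h
    linarith
  · have h := h₄ ⟨X, hX⟩
    change (P.metric.fieldNabla V' (P.fieldPhi ⟨X, hX⟩)
      - P.metric.fieldNabla (P.fieldPhi ⟨X, hX⟩) V')
      - P.fieldPhi (P.metric.fieldNabla V' ⟨X, hX⟩ - P.metric.fieldNabla ⟨X, hX⟩ V') = 0 at h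
    rw [P.metric.fieldNabla_sub, P.metric.fieldNabla_sub] at h
    exact congr($h.1 x)
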